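/- Let $d\ge 0$ be an integer, $L>0$, and let $T^d=(\mathbb R/L\mathbb Z)^d$ be the flat torus (for instance $L=2\pi$). Let $C^\infty(T^d)$ be the space of smooth complex-valued functions on $T^d$, and write $\int_{T^d}f=\int_{T^d}f\,dx_1\cdots dx_d$. For the free scalar field of mass $m\ge 0$, the classical Batalin–Vilkovisky operator is the map $\Delta^{\rm cl}\colon f^\star\mapsto -(-\Delta+m^2)f$ from $C^\infty(T^d)^{-1}$ (a copy of $C^\infty(T^d)$ in degree $-1$, with elements $f^\star$) to $C^\infty(T^d)^{0}$ (a copy in degree $0$), and $$\mathrm{Obs}^{\rm cl}(T^d)=\mathrm{Sym}\bigl(C^\infty(T^d)^{-1}\xrightarrow{\ \Delta^{\rm cl}\ }C^\infty(T^d)^0\bigr)$$ is the (algebraic) graded-symmetric algebra, i.e. the unital algebra generated by these two spaces with the relations $a*b=(-1)^{|a||b|}\,b*a$ for homogeneous generators, with the differential extending $\Delta^{\rm cl}$ as a graded derivation that vanishes on $C^\infty(T^d)^0$. **Theorem.** In the massless case $m=0$, so that $\Delta^{\rm cl}f^\star=\Delta f$: (i) The kernel of $\Delta^{\rm cl}$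 consists of the constant functions, and its image is $\{g\in C^\infty(T^d):\int_{T^d} g=0\}$. The map $f\mapsto\int_{T^d} f$ in both degrees is a quasi-isomorphism from the two-term complex $C^\infty(T^d)\xrightarrow{\Delta^{\rm cl}}C^\infty(T^d)$ to $\mathbb C\xrightarrow{0}\mathbb C$: it is a chain map, and it induces linear isomorphisms $\ker\Delta^{\rm cl}\cong\mathbb C$ and $C^\infty(T^d)/\operatorname{im}\Delta^{\rm cl}\cong\mathbb C$. (ii) There is an isomorphism of $\mathbb Z$-graded $\mathbb C$-algebras $$H^*\,\mathrm{Obs}^{\rm cl}(T^d)\;\cong\;\mathbb C[q,r]/(r^2),\qquad \deg q=0,\quad \deg r=-1,$$ which sends the class $[g]$ of $g\in C^\infty(T^d)^0$ to $\bigl(\int_{T^d} g\bigr)\,q$ and the class $[f^\star]$ of $f^\star\in\ker\Delta^{\rm cl}\subset C^\infty(T^d)^{-1}$ to $\bigl(\int_{T^d} f\bigr)\,r$. -/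

import Mathlib

/-! ### The graded symmetric algebra of a two-term complex -/

namespace GradedSym

section Algebra

variable (V₁ V₀ : Type*) [AddCommGroup V₁] [Module ℂ V₁] [AddCommGroup V₀] [Module ℂ V₀]

/-- The graded commutativity relations `a * b = (-1)^(|a||b|) b * a` between generators, where the
generators `(f, 0)`, `f : V₁`, have degree `-1` and the generators `(0, g)`, `g : V₀`, have
degree `0`. -/
inductive Rel : TensorAlgebra ℂ (V₁ × V₀) → TensorAlgebra ℂ (V₁ × V₀) → Prop
  | even_even (g g' : V₀) :
      Rel (TensorAlgebra.ι ℂ ((0 : V₁), g) * TensorAlgebra.ι ℂ ((0 : V₁), g'))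
        (TensorAlgebra.ι ℂ ((0 : V₁), g') * TensorAlgebra.ι ℂ ((0 : V₁), g))
  | odd_even (f : V₁) (g : V₀) :
      Rel (TensorAlgebra.ι ℂ (f, (0 : V₀)) * TensorAlgebra.ι ℂ ((0 : V₁), g))
        (TensorAlgebra.ι ℂ ((0 : V₁), g) * TensorAlgebra.ι ℂ (f, (0 : V₀)))
  | odd_odd (f f' : V₁) :
      Rel (TensorAlgebra.ι ℂ (f, (0 : V₀)) * TensorAlgebra.ι ℂ (f', (0 : V₀)))
        (-(TensorAlgebra.ι ℂ (f', (0 : V₀)) * TensorAlgebra.ι ℂ (f, (0 : V₀))))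

/-- The symmetric algebra (free graded-commutative unital `ℂ`-algebra) of the graded vector space
with `V₁` in degree `-1` and `V₀` in degree `0`. -/
def Sym : Type _ := RingQuot (Rel V₁ V₀)

noncomputable instance : Ring (Sym V₁ V₀) := inferInstanceAs (Ring (RingQuot (Rel V₁ V₀)))

noncomputable instance : Algebra ℂ (Sym V₁ V₀) :=
  inferInstanceAs (Algebra ℂ (RingQuot (Rel V₁ V₀)))

/-- The quotient map from the tensor algebra. -/
noncomputable def mk : TensorAlgebra ℂ (V₁ × V₀) →ₐ[ℂ] Sym V₁ V₀ :=
  RingQuot.mkAlgHom ℂ (Rel V₁ V₀)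

/-- The generator `f⋆` of degree `-1`. -/
noncomputable def odd : V₁ →ₗ[ℂ] Sym V₁ V₀ :=
  (mk V₁ V₀).toLinearMap ∘ₗ TensorAlgebra.ι ℂ ∘ₗ LinearMap.inl ℂ V₁ V₀

/-- The generator `g` of degree `0`. -/
noncomputable def even : V₀ →ₗ[ℂ] Sym V₁ V₀ :=
  (mk V₁ V₀).toLinearMap ∘ₗ TensorAlgebra.ι ℂ ∘ₗ LinearMap.inr ℂ V₁ V₀

end Algebra

section Universal

variable {V₁ V₀ : Type*} [AddCommGroup V₁] [Module ℂ V₁] [AddCommGroup V₀] [Module ℂ V₀]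

theorem even_mul_even (g g' : V₀) :
    even V₁ V₀ g * even V₁ V₀ g' = even V₁ V₀ g' * even V₁ V₀ g := by
  have h := RingQuot.mkAlgHom_rel ℂ (Rel.even_even (V₁ := V₁) g g')
  rw [map_mul, map_mul] at h
  exact h

theorem odd_mul_even (f : V₁) (g : V₀) :
    odd V₁ V₀ f * even V₁ V₀ g = even V₁ V₀ g * odd V₁ V₀ f := by
  have h := RingQuot.mkAlgHom_rel ℂ (Rel.odd_even (V₁ := V₁) f g)
  rw [map_mul, map_mul] at h
  exact h

theorem odd_mul_odd (f f' : V₁) :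
    odd V₁ V₀ f * odd V₁ V₀ f' = -(odd V₁ V₀ f' * odd V₁ V₀ f) := by
  have h := RingQuot.mkAlgHom_rel ℂ (Rel.odd_odd (V₀ := V₀) f f')
  rw [map_neg, map_mul, map_mul] at h
  exact h

/-- The universal property of `Sym`. -/
noncomputable def lift {A : Type*} [Ring A] [Algebra ℂ A] (u : V₁ →ₗ[ℂ] A) (v : V₀ →ₗ[ℂ] A)
    (hvv : ∀ g g', v g * v g' = v g' * v g) (huv : ∀ f g, u f * v g = v g * u f)
    (huu : ∀ f f', u f * u f' = -(u f' * u f)) : Sym V₁ V₀ →ₐ[ℂ] A :=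
  RingQuot.liftAlgHom ℂ ⟨TensorAlgebra.lift ℂ (u.coprod v), by
    intro x y h
    cases h with
    | even_even g g' => simpa using hvv g g'
    | odd_even f g => simpa using huv f g
    | odd_odd f f' => simpa using huu f f'⟩

section lift
variable {A : Type*} [Ring A] [Algebra ℂ A] (u : V₁ →ₗ[ℂ] A) (v : V₀ →ₗ[ℂ] A)
    (hvv : ∀ g g', v g * v g' = v g' * v g) (huv : ∀ f g, u f * v g = v g * u f)
    (huu : ∀ f f', u f * u f' = -(u f' * u f))

theorem lift_odd (f : V₁) : lift u v hvv huv huu (odd V₁ V₀ f) = u f := by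
  have h := RingQuot.liftAlgHom_mkAlgHom_apply ℂ (TensorAlgebra.lift ℂ (u.coprod v))
    (s := Rel V₁ V₀) (by
      intro x y h
      cases h with
      | even_even g g' => simpa using hvv g g'
      | odd_even f g => simpa using huv f g
      | odd_odd f f' => simpa using huu f f') (TensorAlgebra.ι ℂ (f, 0))
  exact h.trans (by simp)

theorem lift_even (g : V₀) : lift u v hvv huv huu (even V₁ V₀ g) = v g := by
  have h := RingQuot.liftAlgHom_mkAlgHom_apply ℂ (TensorAlgebra.lift ℂ (u.coprod v))
    (s := Rel V₁ V₀) (by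
      intro x y h
      cases h with
      | even_even g g' => simpa using hvv g g'
      | odd_even f g => simpa using huv f g
      | odd_odd f f' => simpa using huu f f') (TensorAlgebra.ι ℂ (0, g))
  exact h.trans (by simp)

end lift

/-- Induction: `Sym` is generated by `V₁` and `V₀`. -/
theorem induction {C : Sym V₁ V₀ → Prop} (hr : ∀ r : ℂ, C (algebraMap ℂ _ r))
    (hodd : ∀ f, C (odd V₁ V₀ f)) (heven : ∀ g, C (even V₁ V₀ g))
    (hmul : ∀ x y, C x → C y → C (x * y)) (hadd : ∀ x y, C x → C y → C (x + y))
    (x : Sym V₁ V₀) : C x := by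
  obtain ⟨t, rfl⟩ := RingQuot.mkAlgHom_surjective ℂ (Rel V₁ V₀) x
  induction t using TensorAlgebra.induction with
  | algebraMap r => rw [AlgHom.commutes]; exact hr r
  | ι p =>
    have h : RingQuot.mkAlgHom ℂ (Rel V₁ V₀) (TensorAlgebra.ι ℂ p)
        = odd V₁ V₀ p.1 + even V₁ V₀ p.2 := by
      change mk V₁ V₀ _ = mk V₁ V₀ _ + mk V₁ V₀ _
      rw [← map_add]
      simp [← map_add]
    rw [h]
    exact hadd _ _ (hodd _) (heven _)
  | mul a b ha hb => rw [map_mul]; exact hmul _ _ ha hb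
  | add a b ha hb => rw [map_add]; exact hadd _ _ ha hb

/-- Algebra homomorphisms out of `Sym` are determined by their values on generators. -/
theorem algHom_ext {A : Type*} [Ring A] [Algebra ℂ A] {φ ψ : Sym V₁ V₀ →ₐ[ℂ] A}
    (h₁ : ∀ f, φ (odd V₁ V₀ f) = ψ (odd V₁ V₀ f))
    (h₀ : ∀ g, φ (even V₁ V₀ g) = ψ (even V₁ V₀ g)) : φ = ψ := by
  ext x
  induction x using GradedSym.induction with
  | hr r => rw [AlgHom.commutes, AlgHom.commutes]
  | hodd f => exact h₁ f
  | heven g => exact h₀ g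
  | hmul x y hx hy => rw [map_mul, map_mul, hx, hy]
  | hadd x y hx hy => rw [map_add, map_add, hx, hy]

end Universal

section Grading

variable (V₁ V₀ : Type*) [AddCommGroup V₁] [Module ℂ V₁] [AddCommGroup V₀] [Module ℂ V₀]

/-- The degree-`n` part of `Sym`: spanned by the products `f₁⋆ * ⋯ * f_k⋆ * g₁ * ⋯ * g_l` with
`n = -k`. -/
noncomputable def degree (n : ℤ) : Submodule ℂ (Sym V₁ V₀) :=
  Submodule.span ℂ {x | ∃ (fs : List V₁) (gs : List V₀), n = -(fs.length : ℤ) ∧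
    x = (fs.map (odd V₁ V₀)).prod * (gs.map (even V₁ V₀)).prod}

variable {V₁ V₀}

theorem odd_mem_degree (f : V₁) : odd V₁ V₀ f ∈ degree V₁ V₀ (-1) :=
  Submodule.subset_span ⟨[f], [], by simp, by simp⟩

theorem even_mem_degree (g : V₀) : even V₁ V₀ g ∈ degree V₁ V₀ 0 :=
  Submodule.subset_span ⟨[], [g], by simp, by simp⟩

theorem prod_even_mul_odd (gs : List V₀) (f : V₁) :
    (gs.map (even V₁ V₀)).prod * odd V₁ V₀ f = odd V₁ V₀ f * (gs.map (even V₁ V₀)).prod := by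
  induction gs with
  | nil => simp
  | cons g gs ih =>
    rw [List.map_cons, List.prod_cons, mul_assoc, ih, ← mul_assoc, ← odd_mul_even, mul_assoc]

theorem prod_even_mul_prod_odd (gs : List V₀) (fs : List V₁) :
    (gs.map (even V₁ V₀)).prod * (fs.map (odd V₁ V₀)).prod
      = (fs.map (odd V₁ V₀)).prod * (gs.map (even V₁ V₀)).prod := by
  induction fs with
  | nil => simp
  | cons f fs ih =>
    rw [List.map_cons, List.prod_cons, ← mul_assoc, prod_even_mul_odd, mul_assoc, ih, mul_assoc]

instance gradedMonoid : SetLike.GradedMonoid (degree V₁ V₀) where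
  one_mem := Submodule.subset_span ⟨[], [], by simp, by simp⟩
  mul_mem := by
    intro m n x y hx hy
    induction hx, hy using Submodule.span_induction₂ with
    | mem_mem x y hx hy =>
      obtain ⟨fs, gs, rfl, rfl⟩ := hx
      obtain ⟨fs', gs', rfl, rfl⟩ := hy
      refine Submodule.subset_span ⟨fs ++ fs', gs ++ gs', by simp; ring, ?_⟩
      rw [List.map_append, List.map_append, List.prod_append, List.prod_append, mul_assoc,
        ← mul_assoc _ (fs'.map _).prod, prod_even_mul_prod_odd]
      simp only [mul_assoc]
    | zero_left => simp
    | zero_right => simp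
    | add_left x y z _ _ _ h h' => rw [add_mul]; exact add_mem h h'
    | add_right x y z _ _ _ h h' => rw [mul_add]; exact add_mem h h'
    | smul_left r x y _ _ h => rw [smul_mul_assoc]; exact Submodule.smul_mem _ _ h
    | smul_right r x y _ _ h => rw [mul_smul_comm]; exact Submodule.smul_mem _ _ h

/-- The generator `f⋆`, placed in the summand of degree `-1`. -/
noncomputable def decomposeOdd : V₁ →ₗ[ℂ] DirectSum ℤ fun n => degree V₁ V₀ n :=
  DirectSum.lof ℂ ℤ (fun n => degree V₁ V₀ n) (-1) ∘ₗ
    (odd V₁ V₀).codRestrict (degree V₁ V₀ (-1)) odd_mem_degree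

/-- The generator `g`, placed in the summand of degree `0`. -/
noncomputable def decomposeEven : V₀ →ₗ[ℂ] DirectSum ℤ fun n => degree V₁ V₀ n :=
  DirectSum.lof ℂ ℤ (fun n => degree V₁ V₀ n) 0 ∘ₗ
    (even V₁ V₀).codRestrict (degree V₁ V₀ 0) even_mem_degree

/-- The decomposition of an element of `Sym` into its homogeneous components. -/
noncomputable def decomposeHom :
    Sym V₁ V₀ →ₐ[ℂ] DirectSum ℤ fun n => degree V₁ V₀ n :=
  lift (A := DirectSum ℤ fun n => degree V₁ V₀ n) decomposeOdd decomposeEven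
    (by
      intro g g'
      change DirectSum.of (fun n => degree V₁ V₀ n) (0) ⟨even V₁ V₀ g, even_mem_degree g⟩ *
          DirectSum.of (fun n => degree V₁ V₀ n) (0) ⟨even V₁ V₀ g', even_mem_degree g'⟩ =
        DirectSum.of (fun n => degree V₁ V₀ n) (0) ⟨even V₁ V₀ g', even_mem_degree g'⟩ *
          DirectSum.of (fun n => degree V₁ V₀ n) (0) ⟨even V₁ V₀ g, even_mem_degree g⟩
      rw [DirectSum.of_mul_of, DirectSum.of_mul_of]
      exact DirectSum.of_eq_of_gradedMonoid_eq (Sigma.subtype_ext rfl (even_mul_even g g')))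
    (by
      intro f g
      change DirectSum.of (fun n => degree V₁ V₀ n) (-1) ⟨odd V₁ V₀ f, odd_mem_degree f⟩ *
          DirectSum.of (fun n => degree V₁ V₀ n) (0) ⟨even V₁ V₀ g, even_mem_degree g⟩ =
        DirectSum.of (fun n => degree V₁ V₀ n) (0) ⟨even V₁ V₀ g, even_mem_degree g⟩ *
          DirectSum.of (fun n => degree V₁ V₀ n) (-1) ⟨odd V₁ V₀ f, odd_mem_degree f⟩
      rw [DirectSum.of_mul_of, DirectSum.of_mul_of]
      exact DirectSum.of_eq_of_gradedMonoid_eq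
        (Sigma.subtype_ext (add_comm _ _) (odd_mul_even f g)))
    (by
      intro f f'
      change DirectSum.of (fun n => degree V₁ V₀ n) (-1) ⟨odd V₁ V₀ f, odd_mem_degree f⟩ *
          DirectSum.of (fun n => degree V₁ V₀ n) (-1) ⟨odd V₁ V₀ f', odd_mem_degree f'⟩ =
        -(DirectSum.of (fun n => degree V₁ V₀ n) (-1) ⟨odd V₁ V₀ f', odd_mem_degree f'⟩ *
          DirectSum.of (fun n => degree V₁ V₀ n) (-1) ⟨odd V₁ V₀ f, odd_mem_degree f⟩)
      rw [DirectSum.of_mul_of, DirectSum.of_mul_of, ← map_neg]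
      exact DirectSum.of_eq_of_gradedMonoid_eq (Sigma.subtype_ext rfl (odd_mul_odd f f')))

theorem decomposeHom_odd (f : V₁) : decomposeHom (odd V₁ V₀ f)
    = DirectSum.of (fun n => degree V₁ V₀ n) (-1) ⟨odd V₁ V₀ f, odd_mem_degree f⟩ := by
  rw [decomposeHom, lift_odd]
  rfl

theorem decomposeHom_even (g : V₀) : decomposeHom (even V₁ V₀ g)
    = DirectSum.of (fun n => degree V₁ V₀ n) 0 ⟨even V₁ V₀ g, even_mem_degree g⟩ := by
  rw [decomposeHom, lift_even]
  rfl

theorem decomposeHom_prod_even (gs : List V₀) (h : (gs.map (even V₁ V₀)).prod ∈ degree V₁ V₀ 0) :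
    decomposeHom (gs.map (even V₁ V₀)).prod
      = DirectSum.of (fun n => degree V₁ V₀ n) 0 ⟨(gs.map (even V₁ V₀)).prod, h⟩ := by
  induction gs with
  | nil => exact map_one _
  | cons g gs ih =>
    have h' : (gs.map (even V₁ V₀)).prod ∈ degree V₁ V₀ 0 :=
      Submodule.subset_span ⟨[], gs, by simp, by simp⟩
    simp only [List.map_cons, List.prod_cons]
    rw [map_mul, ih h', decomposeHom_even, DirectSum.of_mul_of]
    exact DirectSum.of_eq_of_gradedMonoid_eq (Sigma.subtype_ext (add_zero _) rfl)

theorem decomposeHom_mem (n : ℤ) (fs : List V₁) (gs : List V₀) (hn : n = -(fs.length : ℤ))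
    (h : (fs.map (odd V₁ V₀)).prod * (gs.map (even V₁ V₀)).prod ∈ degree V₁ V₀ n) :
    decomposeHom ((fs.map (odd V₁ V₀)).prod * (gs.map (even V₁ V₀)).prod)
      = DirectSum.of (fun n => degree V₁ V₀ n) n
        ⟨(fs.map (odd V₁ V₀)).prod * (gs.map (even V₁ V₀)).prod, h⟩ := by
  induction fs generalizing n with
  | nil =>
    obtain rfl : n = 0 := by simpa using hn
    have h' : (gs.map (even V₁ V₀)).prod ∈ degree V₁ V₀ 0 := by simpa using h
    have e : ((([] : List V₁).map (odd V₁ V₀)).prod * (gs.map (even V₁ V₀)).prod)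
        = (gs.map (even V₁ V₀)).prod := by simp
    refine (congrArg _ e).trans ((decomposeHom_prod_even gs h').trans ?_)
    exact DirectSum.of_eq_of_gradedMonoid_eq (Sigma.subtype_ext rfl e.symm)
  | cons f fs ih =>
    have h' : (fs.map (odd V₁ V₀)).prod * (gs.map (even V₁ V₀)).prod
        ∈ degree V₁ V₀ (-(fs.length : ℤ)) := Submodule.subset_span ⟨fs, gs, rfl, rfl⟩
    have e : (((f :: fs).map (odd V₁ V₀)).prod * (gs.map (even V₁ V₀)).prod)
        = odd V₁ V₀ f * ((fs.map (odd V₁ V₀)).prod * (gs.map (even V₁ V₀)).prod) := by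
      rw [List.map_cons, List.prod_cons, mul_assoc]
    rw [congrArg decomposeHom e, map_mul, ih _ rfl h', decomposeHom_odd, DirectSum.of_mul_of]
    refine DirectSum.of_eq_of_gradedMonoid_eq (Sigma.subtype_ext ?_ e.symm)
    change (-1 : ℤ) + -(fs.length : ℤ) = n
    rw [hn, List.length_cons]
    push_cast
    ring

/-- `Sym` is a `ℤ`-graded algebra, the direct sum of its parts of degree `n`. -/
noncomputable instance gradedAlgebra : GradedAlgebra (degree V₁ V₀) :=
  GradedAlgebra.ofAlgHom _ decomposeHom
    (by
      apply algHom_ext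
      · intro f
        rw [AlgHom.comp_apply, decomposeHom_odd]
        simp
      · intro g
        rw [AlgHom.comp_apply, decomposeHom_even]
        simp)
    (by
      rintro n ⟨x, hx⟩
      induction hx using Submodule.span_induction with
      | mem x hx =>
        obtain ⟨fs, gs, hn, rfl⟩ := id hx
        exact decomposeHom_mem n fs gs hn (Submodule.subset_span hx)
      | zero => simp only [map_zero]; exact (map_zero (DirectSum.of _ n)).symm
      | add x y hx hy h h' =>
        simp only [map_add, h, h']
        exact (map_add (DirectSum.of (fun n => degree V₁ V₀ n) n) ⟨x, hx⟩ ⟨y, hy⟩).symm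
      | smul r x hx h =>
        simp only [map_smul, h]
        exact ((DirectSum.lof ℂ ℤ (fun n => degree V₁ V₀ n) n).map_smul r ⟨x, hx⟩).symm)

end Grading

/-! ### The differential -/

section Differential

variable {V₁ V₀ : Type*} [AddCommGroup V₁] [Module ℂ V₁] [AddCommGroup V₀] [Module ℂ V₀]

/-- The parity involution `x ↦ (-1)^|x| x`. -/
noncomputable def parity : Sym V₁ V₀ →ₐ[ℂ] Sym V₁ V₀ :=
  lift (-odd V₁ V₀) (even V₁ V₀) even_mul_even
    (by intro f g; simp [odd_mul_even]) (by intro f f'; simpa using odd_mul_odd f f')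

theorem parity_odd (f : V₁) : parity (odd V₁ V₀ f) = -odd V₁ V₀ f := lift_odd ..

theorem parity_even (g : V₀) : parity (even V₁ V₀ g) = even V₁ V₀ g := lift_even ..

theorem parity_parity (x : Sym V₁ V₀) : parity (parity x) = x := by
  have h : (parity.comp parity : Sym V₁ V₀ →ₐ[ℂ] Sym V₁ V₀) = AlgHom.id ℂ _ :=
    algHom_ext (by intro f; simp [parity_odd]) (by intro g; simp [parity_even])
  exact DFunLike.congr_fun h x

variable (δ : V₁ →ₗ[ℂ] V₀)

/-- The algebra homomorphism `x ↦ !![(-1)^|x| x, d x; 0, x]`. That it is multiplicative is the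
graded Leibniz rule for `d`. -/
noncomputable def leibnizHom : Sym V₁ V₀ →ₐ[ℂ] Matrix (Fin 2) (Fin 2) (Sym V₁ V₀) :=
  lift
    { toFun := fun f => !![-odd V₁ V₀ f, even V₁ V₀ (δ f); 0, odd V₁ V₀ f]
      map_add' := by
        intro f f'; ext i j; fin_cases i <;> fin_cases j <;> simp [add_comm]
      map_smul' := by
        intro r f; ext i j; fin_cases i <;> fin_cases j <;> simp }
    { toFun := fun g => !![even V₁ V₀ g, 0; 0, even V₁ V₀ g]
      map_add' := by
        intro f f'; ext i j; fin_cases i <;> fin_cases j <;> simp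
      map_smul' := by
        intro r f; ext i j; fin_cases i <;> fin_cases j <;> simp }
    (by intro g g'; simp [even_mul_even g g'])
    (by
      intro f g
      simp [odd_mul_even f g, even_mul_even (δ f) g])
    (by
      intro f f'
      ext i j
      fin_cases i <;> fin_cases j
      · simpa using odd_mul_odd f f'
      · simp [odd_mul_even, add_comm]
      · simp
      · simpa using odd_mul_odd f f')

theorem leibnizHom_odd (f : V₁) : leibnizHom δ (odd V₁ V₀ f)
    = !![-odd V₁ V₀ f, even V₁ V₀ (δ f); 0, odd V₁ V₀ f] := lift_odd ..

theorem leibnizHom_even (g : V₀) : leibnizHom δ (even V₁ V₀ g)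
    = !![even V₁ V₀ g, 0; 0, even V₁ V₀ g] := lift_even ..

/-- The differential on `Sym` extending `f⋆ ↦ δ f`, `g ↦ 0` as a graded derivation. -/
noncomputable def differential : Sym V₁ V₀ →ₗ[ℂ] Sym V₁ V₀ where
  toFun x := leibnizHom δ x 0 1
  map_add' x y := by rw [map_add]; rfl
  map_smul' r x := by rw [map_smul]; rfl

theorem leibnizHom_apply (x : Sym V₁ V₀) :
    leibnizHom δ x = !![parity x, differential δ x; 0, x] := by
  have key : leibnizHom δ x 0 0 = parity x ∧ leibnizHom δ x 1 0 = 0 ∧ leibnizHom δ x 1 1 = x := by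
    induction x using GradedSym.induction with
    | hr r => simp [Matrix.algebraMap_matrix_apply]
    | hodd f => simp [leibnizHom_odd, parity_odd]
    | heven g => simp [leibnizHom_even, parity_even]
    | hmul x y hx hy => simp [Matrix.mul_apply, Fin.sum_univ_two, hx, hy]
    | hadd x y hx hy => simp [hx, hy]
  ext i j
  fin_cases i <;> fin_cases j
  · exact key.1
  · rfl
  · exact key.2.1
  · exact key.2.2

theorem differential_odd (f : V₁) : differential δ (odd V₁ V₀ f) = even V₁ V₀ (δ f) := by
  change leibnizHom δ _ 0 1 = _
  simp [leibnizHom_odd]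

theorem differential_even (g : V₀) : differential δ (even V₁ V₀ g) = 0 := by
  change leibnizHom δ _ 0 1 = _
  simp [leibnizHom_even]

theorem differential_algebraMap (r : ℂ) : differential δ (algebraMap ℂ (Sym V₁ V₀) r) = 0 := by
  change leibnizHom δ _ 0 1 = _
  simp [Matrix.algebraMap_matrix_apply]

/-- The graded Leibniz rule `d (x * y) = d x * y + (-1)^|x| x * d y`. -/
theorem differential_mul (x y : Sym V₁ V₀) :
    differential δ (x * y) = differential δ x * y + parity x * differential δ y := by
  have h : differential δ (x * y) = (leibnizHom δ x * leibnizHom δ y) 0 1 := by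
    rw [← map_mul]; rfl
  rw [h, leibnizHom_apply, leibnizHom_apply]
  simp [Matrix.mul_apply, Fin.sum_univ_two, add_comm]

theorem differential_parity (x : Sym V₁ V₀) :
    differential δ (parity x) = -parity (differential δ x) := by
  induction x using GradedSym.induction with
  | hr r => simp [differential_algebraMap]
  | hodd f => simp [parity_odd, differential_odd, parity_even]
  | heven g => simp [parity_even, differential_even]
  | hmul x y hx hy =>
    simp only [map_mul, map_add, differential_mul, hx, hy, neg_mul, mul_neg, neg_add]
  | hadd x y hx hy => simp [hx, hy, add_comm]

/-- The differential squares to zero. -/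
theorem differential_differential (x : Sym V₁ V₀) : differential δ (differential δ x) = 0 := by
  induction x using GradedSym.induction with
  | hr r => simp [differential_algebraMap]
  | hodd f => simp [differential_odd, differential_even]
  | heven g => simp [differential_even]
  | hmul x y hx hy => simp [differential_mul, differential_parity, hx, hy]
  | hadd x y hx hy => simp [hx, hy]

/-- The differential raises the degree by one. -/
theorem differential_mem_degree (n : ℤ) (x : Sym V₁ V₀) (hx : x ∈ degree V₁ V₀ n) :
    differential δ x ∈ degree V₁ V₀ (n + 1) := by
  have hev : ∀ gs : List V₀, differential δ (gs.map (even V₁ V₀)).prod = 0 := by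
    intro gs
    induction gs with
    | nil => simpa using differential_algebraMap δ 1
    | cons g gs ih => simp [differential_mul, differential_even, ih]
  induction hx using Submodule.span_induction with
  | mem x hx =>
    obtain ⟨fs, gs, rfl, rfl⟩ := hx
    induction fs with
    | nil => simp [hev]
    | cons f fs ih =>
      simp only [List.map_cons, List.prod_cons, mul_assoc, List.length_cons]
      rw [differential_mul, differential_odd, parity_odd]
      refine add_mem ?_ ?_
      · have := SetLike.mul_mem_graded (even_mem_degree (V₁ := V₁) (δ f))
          (Submodule.subset_span ⟨fs, gs, rfl, rfl⟩ : _ ∈ degree V₁ V₀ (-(fs.length : ℤ)))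
        convert this using 2
        push_cast
        ring
      · rw [neg_mul]
        refine neg_mem ?_
        have := SetLike.mul_mem_graded (odd_mem_degree (V₀ := V₀) f) ih
        convert this using 2
        push_cast
        ring
  | zero => simp
  | add x y _ _ h h' => rw [map_add]; exact add_mem h h'
  | smul r x _ h => rw [map_smul]; exact Submodule.smul_mem _ _ h

/-! ### The cohomology algebra -/

/-- The algebra of cocycles. -/
noncomputable def cocycles : Subalgebra ℂ (Sym V₁ V₀) where
  carrier := {x | differential δ x = 0}
  mul_mem' := by
    intro x y hx hy
    simp only [Set.mem_ofPred_eq] at hx hy ⊢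
    rw [differential_mul, hx, hy, zero_mul, mul_zero, add_zero]
  add_mem' := by
    intro x y hx hy
    simp only [Set.mem_ofPred_eq] at hx hy ⊢
    rw [map_add, hx, hy, add_zero]
  algebraMap_mem' := differential_algebraMap δ

/-- The ideal of coboundaries in the algebra of cocycles. -/
noncomputable def coboundaries : Ideal (cocycles δ) where
  carrier := {z | ∃ y, differential δ y = z}
  zero_mem' := ⟨0, by simp⟩
  add_mem' := by
    rintro _ _ ⟨x, hx⟩ ⟨y, hy⟩
    exact ⟨x + y, by rw [map_add, hx, hy]; rfl⟩
  smul_mem' := by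
    rintro ⟨c, hc⟩ z ⟨y, hy⟩
    have hc' : differential δ c = 0 := hc
    refine ⟨parity c * y, ?_⟩
    rw [differential_mul, differential_parity, hc', parity_parity, hy]
    simp

instance : (coboundaries δ).IsTwoSided where
  mul_mem_of_left := by
    rintro z ⟨c, hc⟩ ⟨y, hy⟩
    have hc' : differential δ c = 0 := hc
    refine ⟨y * c, ?_⟩
    rw [differential_mul, hc', hy]
    simp

/-- The cohomology algebra of the differential graded algebra `(Sym, d)`. -/
abbrev Cohomology : Type _ := cocycles δ ⧸ coboundaries δ

/-- The cohomology class of a cocycle. -/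
noncomputable def cohomologyClass : cocycles δ →ₐ[ℂ] Cohomology δ :=
  Ideal.Quotient.mkₐ ℂ (coboundaries δ)

/-- The class `[g]` of a generator of degree `0`. -/
noncomputable def evenClass (g : V₀) : Cohomology δ :=
  cohomologyClass δ ⟨even V₁ V₀ g, differential_even δ g⟩

/-- The class `[f⋆]` of a generator of degree `-1` with `δ f = 0`. -/
noncomputable def oddClass (f : LinearMap.ker δ) : Cohomology δ :=
  cohomologyClass δ ⟨odd V₁ V₀ f, by
    have hf : δ f = 0 := f.2
    change differential δ (odd V₁ V₀ f) = 0
    rw [differential_odd, hf, map_zero]⟩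

/-- The degree-`n` cohomology: the classes of the cocycles of degree `n`. -/
noncomputable def cohomologyDegree (n : ℤ) : Submodule ℂ (Cohomology δ) :=
  ((degree V₁ V₀ n).comap (cocycles δ).val.toLinearMap).map (cohomologyClass δ).toLinearMap

end Differential

end GradedSym
/-! ### Smooth functions on the torus -/

/-- The torus `T^d = (ℝ/Lℤ)^d`. -/
abbrev Torus (d : ℕ) (L : ℝ) : Type := Fin d → AddCircle L

namespace Torus

variable (d : ℕ) (L : ℝ)

/-- The covering map `ℝ^d → T^d`. -/
def proj (x : EuclideanSpace ℝ (Fin d)) : Torus d L := fun i => (x i : AddCircle L)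

theorem proj_surjective : Function.Surjective (proj d L) := by
  intro t
  choose x hx using fun i => QuotientAddGroup.mk_surjective (t i)
  exact ⟨WithLp.toLp 2 x, funext hx⟩

/-- The space `C^∞(T^d)` of smooth complex-valued functions on the torus. As the covering map
`ℝ^d → T^d` is a local diffeomorphism, a function on `T^d` is smooth iff its pullback to `ℝ^d`
is. (`T^d` is compact, so these are also the compactly supported smooth functions.) -/
def Smooth : Submodule ℂ (Torus d L → ℂ) where
  carrier := {f | ContDiff ℝ (⊤ : ℕ∞) (f ∘ proj d L)}
  zero_mem' := by
    change ContDiff ℝ (⊤ : ℕ∞) (fun _ => (0 : ℂ))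
    exact contDiff_const
  add_mem' {f g} hf hg := by
    change ContDiff ℝ (⊤ : ℕ∞) (f ∘ proj d L) at hf
    change ContDiff ℝ (⊤ : ℕ∞) (g ∘ proj d L) at hg
    exact hf.add hg
  smul_mem' c f hf := by
    change ContDiff ℝ (⊤ : ℕ∞) (f ∘ proj d L) at hf
    exact hf.const_smul c

variable {d L}

/-- The pullback of a smooth function on the torus to `ℝ^d`. -/
def pullback (f : Smooth d L) : EuclideanSpace ℝ (Fin d) → ℂ := (f : Torus d L → ℂ) ∘ proj d L

theorem contDiff_pullback (f : Smooth d L) : ContDiff ℝ (⊤ : ℕ∞) (pullback f) := f.2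

theorem proj_add_of_proj_eq {x y : EuclideanSpace ℝ (Fin d)} (h : proj d L x = proj d L y)
    (z : EuclideanSpace ℝ (Fin d)) : proj d L (z + (y - x)) = proj d L z := by
  funext i
  have hi := congrFun h i
  simp only [proj] at hi ⊢
  simp [hi]

theorem contDiff_laplacian {g : EuclideanSpace ℝ (Fin d) → ℂ} (hg : ContDiff ℝ (⊤ : ℕ∞) g) :
    ContDiff ℝ (⊤ : ℕ∞) (Laplacian.laplacian g) := by
  rw [InnerProductSpace.laplacian_eq_iteratedFDeriv_stdOrthonormalBasis]
  refine ContDiff.sum fun i _ => ?_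
  have h : ContDiff ℝ (⊤ : ℕ∞) (iteratedFDeriv ℝ 2 g) := hg.iteratedFDeriv_right (by decide)
  exact (ContinuousMultilinearMap.apply ℝ _ ℂ _).contDiff.comp h

theorem laplacian_pullback_eq (f : Smooth d L) {x y : EuclideanSpace ℝ (Fin d)}
    (h : proj d L x = proj d L y) :
    Laplacian.laplacian (pullback f) x = Laplacian.laplacian (pullback f) y := by
  have hp : (fun z => pullback f (z + (y - x))) = pullback f := by
    funext z
    simp only [pullback, Function.comp_apply, proj_add_of_proj_eq h]
  rw [InnerProductSpace.laplacian_eq_iteratedFDeriv_stdOrthonormalBasis]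
  have h2 : iteratedFDeriv ℝ 2 (pullback f) x = iteratedFDeriv ℝ 2 (pullback f) y := by
    conv_lhs => rw [← hp]
    rw [iteratedFDeriv_comp_add_right]
    simp
  simp only [h2]

/-- The Laplacian `Δ f = ∑ i, ∂²f/∂x_i²` of a smooth function on the torus, computed on the
covering space. -/
noncomputable def lap (f : Smooth d L) : Smooth d L :=
  ⟨fun t => Laplacian.laplacian (pullback f) (Function.surjInv (proj_surjective d L) t), by
    have h : ((fun t => Laplacian.laplacian (pullback f)
        (Function.surjInv (proj_surjective d L) t)) ∘ proj d L)
        = Laplacian.laplacian (pullback f) := by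
      funext x
      exact laplacian_pullback_eq f (Function.surjInv_eq (proj_surjective d L) (proj d L x))
    change ContDiff ℝ (⊤ : ℕ∞) _
    rw [h]
    exact contDiff_laplacian (contDiff_pullback f)⟩

theorem pullback_lap (f : Smooth d L) : pullback (lap f) = Laplacian.laplacian (pullback f) := by
  funext x
  exact laplacian_pullback_eq f (Function.surjInv_eq (proj_surjective d L) (proj d L x))

theorem pullback_injective : Function.Injective (pullback : Smooth d L → _) := by
  intro f g h
  apply Subtype.ext
  funext t
  obtain ⟨x, rfl⟩ := proj_surjective d L t
  exact congrFun h x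

/-- The Laplacian as a `ℂ`-linear map. -/
noncomputable def laplacian : Smooth d L →ₗ[ℂ] Smooth d L where
  toFun := lap
  map_add' f g := by
    apply pullback_injective
    have hf : ContDiff ℝ 2 (pullback f) := (contDiff_pullback f).of_le (by decide)
    have hg : ContDiff ℝ 2 (pullback g) := (contDiff_pullback g).of_le (by decide)
    have h : pullback (lap f + lap g) = pullback (lap f) + pullback (lap g) := rfl
    rw [h, pullback_lap, pullback_lap, pullback_lap]
    funext x
    exact hf.contDiffAt.laplacian_add hg.contDiffAt
  map_smul' c f := by
    apply pullback_injective
    have hf : ContDiff ℝ 2 (pullback f) := (contDiff_pullback f).of_le (by decide)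
    have h : pullback (c • lap f) = c • pullback (lap f) := rfl
    rw [RingHom.id_apply, h, pullback_lap, pullback_lap]
    funext x
    exact InnerProductSpace.laplacian_smul c hf.contDiffAt

/-- The constant function on the torus with value `c`. -/
def const (c : ℂ) : Smooth d L :=
  ⟨fun _ => c, (contDiff_const : ContDiff ℝ (⊤ : ℕ∞) fun _ => c)⟩

/-- The integral `∫_{T^d} f dx₁ ⋯ dx_d` (the torus has total volume `L^d`). -/
noncomputable def integral [Fact (0 < L)] (f : Smooth d L) : ℂ :=
  ∫ t : Torus d L, (f : Torus d L → ℂ) t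

end Torus

/-! ### Classical observables of the free scalar field on the torus -/

namespace FreeScalar

variable (d : ℕ) (L m : ℝ)

/-- The classical Batalin–Vilkovisky operator `f⋆ ↦ -(-Δ + m²) f` on linear observables, for the
free scalar field of mass `m`. -/
noncomputable def bvOperator : Torus.Smooth d L →ₗ[ℂ] Torus.Smooth d L :=
  -(-Torus.laplacian + ((m : ℂ) ^ 2) • LinearMap.id)

/-- The underlying algebra of `Obs^cl(T^d) = Sym (C^∞(T^d)⁻¹ → C^∞(T^d)⁰)`; its differential is
`GradedSym.differential (bvOperator d L m)`. -/
abbrev Obs : Type := GradedSym.Sym (Torus.Smooth d L) (Torus.Smooth d L)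

/-- The classical Batalin–Vilkovisky cohomology `H^*(Obs^cl(T^d))`. -/
abbrev ObsCohomology : Type := GradedSym.Cohomology (bvOperator d L m)

end FreeScalar

/-! ### The graded algebra `ℂ[q, r]/(r²)` -/

namespace DualPoly
open MvPolynomial

/-- The algebra `ℂ[q, r]/(r²)`. -/
abbrev Alg : Type := MvPolynomial (Fin 2) ℂ ⧸ Ideal.span {(X 1 : MvPolynomial (Fin 2) ℂ) ^ 2}

/-- The generator `q`, of degree `0`. -/
noncomputable def q : Alg := Ideal.Quotient.mk _ (X 0)

/-- The generator `r`, of degree `-1`. -/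
noncomputable def r : Alg := Ideal.Quotient.mk _ (X 1)

/-- The degree-`n` part of `ℂ[q, r]/(r²)`: spanned by the monomials `q^a r^b` with `n = -b`. -/
noncomputable def degree (n : ℤ) : Submodule ℂ Alg :=
  Submodule.span ℂ {x | ∃ a b : ℕ, n = -(b : ℤ) ∧ x = q ^ a * r ^ b}

end DualPoly

/-! ### The cohomology of the symmetric algebra of a contractible complex plus `ℂ → ℂ` -/

/-! The proof has an algebraic half and an analytic half.

Algebra. Suppose `δ : V₁ → V₀` retracts onto `0 : ℂ → ℂ` with homotopy `G`. Extend `G` to a graded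
derivation `s` of `Sym` of degree `-1`. The Euler operator `E = d s + s d` is then an ordinary
derivation commuting with `d`. On generators it is the idempotent complementary to the retract, so
it kills `i₁` and `i₀` and acts by `k` on products containing exactly `k` complementary factors.
Hence `x - incl (proj x)` always lies in the sum of the eigenspaces of `E` for positive integers
(`sub_incl_proj_mem_positivePart`). On cocycles there, `E` is invertible and equal to `d s`, so they
are coboundaries (`exists_differential_eq_of_aeval_euler`). Thus `proj : Sym → ℂ[q, r]/(r²)` is
injective on cohomology, and `incl` makes it surjective. A retraction exists as soon as the kernel
and cokernel of `δ` are lines detected by `p₁` and `p₀` (`exists_retraction`).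

Analysis. It remains to see that `∫` detects the kernel and cokernel of the Laplacian. Smooth
functions on the torus are exactly the sums of Fourier series with rapidly decreasing coefficients
(`rapidDecay_coeff`, `pullback_eq_series`, `RapidDecay.contDiff_series`). The Laplacian multiplies
the `n`-th coefficient by an eigenvalue that vanishes only at `n = 0` and is otherwise bounded away
from zero (`le_norm_eigenvalue`). So the kernel is the constants, and division by the eigenvalues
solves `Δ f = g` exactly when the zeroth coefficient, a nonzero multiple of `∫ g`, vanishes. -/

namespace GradedSym

section Derivation

variable {V₁ V₀ : Type*} [AddCommGroup V₁] [Module ℂ V₁] [AddCommGroup V₀] [Module ℂ V₀]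
  (δ : V₁ →ₗ[ℂ] V₀) (G : V₀ →ₗ[ℂ] V₁)

/-- The algebra homomorphism `x ↦ !![(-1)^|x| x, s x; 0, x]`, where `s` is the graded derivation of
degree `-1` extending `g ↦ (G g)⋆`, `f⋆ ↦ 0`. -/
noncomputable def homotopyHom : Sym V₁ V₀ →ₐ[ℂ] Matrix (Fin 2) (Fin 2) (Sym V₁ V₀) :=
  lift
    { toFun := fun f => !![-odd V₁ V₀ f, 0; 0, odd V₁ V₀ f]
      map_add' := by
        intro f f'; ext i j; fin_cases i <;> fin_cases j <;> simp [add_comm]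
      map_smul' := by
        intro r f; ext i j; fin_cases i <;> fin_cases j <;> simp }
    { toFun := fun g => !![even V₁ V₀ g, odd V₁ V₀ (G g); 0, even V₁ V₀ g]
      map_add' := by
        intro f f'; ext i j; fin_cases i <;> fin_cases j <;> simp
      map_smul' := by
        intro r f; ext i j; fin_cases i <;> fin_cases j <;> simp }
    (by
      intro g g'
      simp [even_mul_even g g', odd_mul_even, add_comm])
    -- The off-diagonal entries agree because `f⋆` anticommutes with `(G g)⋆`; this is what the sign
    -- in the parity entry is for.
    (by
      intro f g
      simp [odd_mul_even f g, odd_mul_odd f (G g)])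
    (by
      intro f f'
      ext i j
      fin_cases i <;> fin_cases j
      · simpa using odd_mul_odd f f'
      · simp
      · simp
      · simpa using odd_mul_odd f f')

theorem homotopyHom_odd (f : V₁) : homotopyHom G (odd V₁ V₀ f)
    = !![-odd V₁ V₀ f, 0; 0, odd V₁ V₀ f] := lift_odd ..

theorem homotopyHom_even (g : V₀) : homotopyHom G (even V₁ V₀ g)
    = !![even V₁ V₀ g, odd V₁ V₀ (G g); 0, even V₁ V₀ g] := lift_even ..

/-- The graded derivation of degree `-1` extending `g ↦ (G g)⋆`, `f⋆ ↦ 0`. -/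
noncomputable def homotopy : Sym V₁ V₀ →ₗ[ℂ] Sym V₁ V₀ where
  toFun x := homotopyHom G x 0 1
  map_add' x y := by rw [map_add]; rfl
  map_smul' r x := by rw [map_smul]; rfl

theorem homotopyHom_apply (x : Sym V₁ V₀) :
    homotopyHom G x = !![parity x, homotopy G x; 0, x] := by
  have key : homotopyHom G x 0 0 = parity x ∧ homotopyHom G x 1 0 = 0 ∧
      homotopyHom G x 1 1 = x := by
    induction x using GradedSym.induction with
    | hr r => simp [Matrix.algebraMap_matrix_apply]
    | hodd f => simp [homotopyHom_odd, parity_odd]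
    | heven g => simp [homotopyHom_even, parity_even]
    | hmul x y hx hy => simp [Matrix.mul_apply, Fin.sum_univ_two, hx, hy]
    | hadd x y hx hy => simp [hx, hy]
  ext i j
  fin_cases i <;> fin_cases j
  · exact key.1
  · rfl
  · exact key.2.1
  · exact key.2.2

theorem homotopy_odd (f : V₁) : homotopy G (odd V₁ V₀ f) = 0 := by
  change homotopyHom G _ 0 1 = _
  simp [homotopyHom_odd]

theorem homotopy_even (g : V₀) : homotopy G (even V₁ V₀ g) = odd V₁ V₀ (G g) := by
  change homotopyHom G _ 0 1 = _
  simp [homotopyHom_even]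

theorem homotopy_algebraMap (r : ℂ) : homotopy G (algebraMap ℂ (Sym V₁ V₀) r) = 0 := by
  change homotopyHom G _ 0 1 = _
  simp [Matrix.algebraMap_matrix_apply]

theorem homotopy_mul (x y : Sym V₁ V₀) :
    homotopy G (x * y) = homotopy G x * y + parity x * homotopy G y := by
  have h : homotopy G (x * y) = (homotopyHom G x * homotopyHom G y) 0 1 := by
    rw [← map_mul]; rfl
  rw [h, homotopyHom_apply, homotopyHom_apply]
  simp [Matrix.mul_apply, Fin.sum_univ_two, add_comm]

theorem homotopy_parity (x : Sym V₁ V₀) :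
    homotopy G (parity x) = -parity (homotopy G x) := by
  induction x using GradedSym.induction with
  | hr r => simp [homotopy_algebraMap]
  | hodd f => simp [parity_odd, homotopy_odd]
  | heven g => simp [parity_even, parity_odd, homotopy_even]
  | hmul x y hx hy =>
    simp only [map_mul, map_add, homotopy_mul, hx, hy, neg_mul, mul_neg, neg_add]
  | hadd x y hx hy => simp [hx, hy, add_comm]

/-- The anticommutator of the differential and the homotopy. -/
noncomputable def euler : Module.End ℂ (Sym V₁ V₀) :=
  differential δ ∘ₗ homotopy G + homotopy G ∘ₗ differential δ

theorem euler_apply (x : Sym V₁ V₀) :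
    euler δ G x = differential δ (homotopy G x) + homotopy G (differential δ x) := rfl

/-- The anticommutator of two odd derivations is an even derivation: both anticommute with `parity`,
so the cross terms cancel. -/
theorem euler_mul (x y : Sym V₁ V₀) :
    euler δ G (x * y) = euler δ G x * y + x * euler δ G y := by
  simp only [euler_apply, homotopy_mul, differential_mul, map_add, differential_parity,
    homotopy_parity, parity_parity, neg_mul, mul_add, add_mul]
  abel

theorem euler_odd (f : V₁) : euler δ G (odd V₁ V₀ f) = odd V₁ V₀ (G (δ f)) := by
  rw [euler_apply, homotopy_odd, differential_odd, homotopy_even, map_zero, zero_add]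

theorem euler_even (g : V₀) : euler δ G (even V₁ V₀ g) = even V₁ V₀ (δ (G g)) := by
  rw [euler_apply, homotopy_even, differential_odd, differential_even, map_zero, add_zero]

theorem euler_algebraMap (r : ℂ) : euler δ G (algebraMap ℂ (Sym V₁ V₀) r) = 0 := by
  simp [euler_apply, homotopy_algebraMap, differential_algebraMap]

theorem differential_euler (x : Sym V₁ V₀) :
    differential δ (euler δ G x) = euler δ G (differential δ x) := by
  simp [euler_apply, differential_differential]

theorem differential_aeval_euler (p : Polynomial ℂ) {x : Sym V₁ V₀} (hx : differential δ x = 0) :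
    differential δ (Polynomial.aeval (euler δ G) p x) = 0 := by
  induction p using Polynomial.induction_on' with
  | add p q hp hq => simp [hp, hq]
  | monomial n a =>
    have h : differential δ ((euler δ G ^ n) x) = 0 := by
      induction n with
      | zero => simpa using hx
      | succ n ih => rw [pow_succ', Module.End.mul_apply, differential_euler, ih, map_zero]
    simp [Polynomial.aeval_monomial, h]

/-- A cocycle annihilated by a polynomial in the Euler operator with nonzero constant term is a
coboundary. -/
theorem exists_differential_eq_of_aeval_euler {x : Sym V₁ V₀} (hx : differential δ x = 0)
    {p : Polynomial ℂ} (hp : p.coeff 0 ≠ 0) (hpx : Polynomial.aeval (euler δ G) p x = 0) :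
    ∃ y, differential δ y = x := by
  -- Write `p = X * q + p(0)` and `z = q(E) x`. Then `z` is a cocycle, so `E z = d (s z)`, while
  -- `p(E) x = 0` says `E z = -p(0) x`.
  set z := Polynomial.aeval (euler δ G) p.divX x with hz
  have hdz : differential δ z = 0 := differential_aeval_euler δ G _ hx
  have h : euler δ G z + p.coeff 0 • x = 0 := by
    have e := congrArg (fun q => Polynomial.aeval (euler δ G) q x) (Polynomial.X_mul_divX_add p)
    simp only [map_add, map_mul, Polynomial.aeval_X, Polynomial.aeval_C, LinearMap.add_apply,
      Module.End.mul_apply, Module.algebraMap_end_apply, hpx] at e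
    exact e
  refine ⟨-((p.coeff 0)⁻¹ • homotopy G z), ?_⟩
  rw [euler_apply, hdz, map_zero, add_zero] at h
  rw [map_neg, map_smul, eq_neg_of_add_eq_zero_left h, smul_neg, neg_neg, inv_smul_smul₀ hp]

/-- The sum of the eigenspaces of the Euler operator for positive integers. -/
noncomputable def positivePart : Submodule ℂ (Sym V₁ V₀) :=
  ⨆ n : ℕ, Module.End.eigenspace (euler δ G) ((n : ℂ) + 1)

variable {δ G}

theorem mem_positivePart {x : Sym V₁ V₀} (n : ℕ) (hx : euler δ G x = ((n : ℂ) + 1) • x) :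
    x ∈ positivePart δ G :=
  Submodule.mem_iSup_of_mem n (Module.End.mem_eigenspace_iff.2 hx)

theorem positivePart_induction {C : Sym V₁ V₀ → Prop} {x : Sym V₁ V₀}
    (hx : x ∈ positivePart δ G)
    (heigen : ∀ (n : ℕ) x, euler δ G x = ((n : ℂ) + 1) • x → C x) (hzero : C 0)
    (hadd : ∀ x y, C x → C y → C (x + y)) : C x :=
  Submodule.iSup_induction _ (motive := C) hx
    (fun n x h => heigen n x (Module.End.mem_eigenspace_iff.1 h)) hzero hadd

theorem mul_mem_positivePart {x y : Sym V₁ V₀} (hx : x ∈ positivePart δ G)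
    (hy : y ∈ positivePart δ G) : x * y ∈ positivePart δ G := by
  refine positivePart_induction (C := fun x => x * y ∈ _) hx (fun n x hn => ?_) (by simp) fun x x' h h' => by
    rw [add_mul]; exact add_mem h h'
  refine positivePart_induction (C := fun y => x * y ∈ _) hy (fun m y hm => ?_) (by simp) fun y y' h h' => by
    rw [mul_add]; exact add_mem h h'
  -- Eigenvalues of a derivation add under products: `(n + 1) + (m + 1) = (n + m + 1) + 1`.
  refine mem_positivePart (n + m + 1) ?_
  rw [euler_mul, hn, hm, smul_mul_assoc, mul_smul_comm, ← add_smul]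
  congr 1
  push_cast
  ring

theorem mul_mem_positivePart_left {x y : Sym V₁ V₀} (hx : euler δ G x = 0)
    (hy : y ∈ positivePart δ G) : x * y ∈ positivePart δ G := by
  refine positivePart_induction (C := fun y => x * y ∈ _) hy (fun m y hm => mem_positivePart m ?_) (by simp)
    fun y y' h h' => by rw [mul_add]; exact add_mem h h'
  rw [euler_mul, hx, hm, zero_mul, zero_add, mul_smul_comm]

theorem mul_mem_positivePart_right {x y : Sym V₁ V₀} (hx : x ∈ positivePart δ G)
    (hy : euler δ G y = 0) : x * y ∈ positivePart δ G := by
  refine positivePart_induction (C := fun x => x * y ∈ _) hx (fun m x hm => mem_positivePart m ?_) (by simp)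
    fun y y' h h' => by rw [add_mul]; exact add_mem h h'
  rw [euler_mul, hy, hm, mul_zero, add_zero, smul_mul_assoc]

/-- An eigenvector for `n + 1` is killed by `X - (n + 1)`, and a sum by the product of the
annihilators of its terms. A single polynomial makes it unnecessary to split a cocycle into
eigencomponents. -/
theorem exists_aeval_euler_of_mem_positivePart {x : Sym V₁ V₀} (hx : x ∈ positivePart δ G) :
    ∃ p : Polynomial ℂ, p.coeff 0 ≠ 0 ∧ Polynomial.aeval (euler δ G) p x = 0 := by
  refine positivePart_induction
    (C := fun x => ∃ p : Polynomial ℂ, p.coeff 0 ≠ 0 ∧ Polynomial.aeval (euler δ G) p x = 0)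
    hx (fun n x hn => ?_) ⟨1, by simp, by simp⟩ ?_
  · refine ⟨Polynomial.X - Polynomial.C ((n : ℂ) + 1), ?_, ?_⟩
    · have : (n : ℂ) + 1 ≠ 0 := by exact_mod_cast n.succ_ne_zero
      simpa [sub_eq_zero, ← neg_add_rev, add_comm] using this
    · rw [map_sub, Polynomial.aeval_X, Polynomial.aeval_C, LinearMap.sub_apply,
        Module.algebraMap_end_apply, hn, sub_self]
  · rintro x y ⟨p, hp, hpx⟩ ⟨q, hq, hqy⟩
    refine ⟨p * q, by simp [Polynomial.mul_coeff_zero, hp, hq], ?_⟩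
    rw [map_add]
    -- On each summand, its own annihilator has to act first.
    nth_rewrite 1 [mul_comm p q]
    rw [map_mul, map_mul, Module.End.mul_apply, Module.End.mul_apply, hpx, hqy, map_zero, map_zero,
      add_zero]

end Derivation

end GradedSym

/-! ### Maps out of `ℂ[q, r]/(r²)` and its grading -/

namespace DualPoly

open MvPolynomial

theorem r_mul_r : r * r = 0 := by
  rw [← pow_two, r, ← map_pow, Ideal.Quotient.eq_zero_iff_mem]
  exact Ideal.subset_span rfl

open scoped IsMulCommutative in
/-- The algebra homomorphism out of `ℂ[q, r]/(r²)` given by commuting elements `a`, `b` of a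
possibly noncommutative algebra with `b² = 0`. -/
theorem exists_algHom {A : Type*} [Ring A] [Algebra ℂ A] (a b : A) (hab : a * b = b * a)
    (hb : b * b = 0) : ∃ φ : Alg →ₐ[ℂ] A, φ q = a ∧ φ r = b := by
  have hcomm : ∀ x ∈ ({a, b} : Set A), ∀ y ∈ ({a, b} : Set A), x * y = y * x := by
    rintro x (rfl | rfl) y (rfl | rfl) <;> first | rfl | exact hab | exact hab.symm
  -- Evaluating polynomials requires a commutative target, so the map is built into the commutative
  -- subalgebra generated by `a` and `b`.
  have := Algebra.isMulCommutative_adjoin ℂ hcomm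
  let a' : Algebra.adjoin ℂ ({a, b} : Set A) := ⟨a, Algebra.subset_adjoin (by simp)⟩
  let b' : Algebra.adjoin ℂ ({a, b} : Set A) := ⟨b, Algebra.subset_adjoin (by simp)⟩
  let e : MvPolynomial (Fin 2) ℂ →ₐ[ℂ] Algebra.adjoin ℂ ({a, b} : Set A) := aeval ![a', b']
  have hX0 : e (X 0) = a' := by simp [e]
  have hX1 : e (X 1) = b' := by simp [e]
  have he : ∀ p ∈ Ideal.span {(X 1 : MvPolynomial (Fin 2) ℂ) ^ 2}, e p = 0 := by
    intro p hp
    obtain ⟨c, rfl⟩ := Ideal.mem_span_singleton'.1 hp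
    have hb' : b' ^ 2 = 0 := Subtype.ext (by rw [pow_two]; exact hb)
    rw [map_mul, map_pow, hX1, hb', mul_zero]
  refine ⟨(Algebra.adjoin ℂ ({a, b} : Set A)).val.comp (Ideal.Quotient.liftₐ _ e he), ?_, ?_⟩
  · change ((e (X 0) : Algebra.adjoin ℂ ({a, b} : Set A)) : A) = a
    rw [hX0]
  · change ((e (X 1) : Algebra.adjoin ℂ ({a, b} : Set A)) : A) = b
    rw [hX1]

theorem algHom_ext {A : Type*} [Semiring A] [Algebra ℂ A] {φ ψ : Alg →ₐ[ℂ] A} (hq : φ q = ψ q)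
    (hr : φ r = ψ r) : φ = ψ := by
  refine Ideal.Quotient.algHom_ext _ (MvPolynomial.algHom_ext fun i => ?_)
  fin_cases i
  · exact hq
  · exact hr

theorem mul_mem_degree {m n : ℤ} {x y : Alg} (hx : x ∈ degree m) (hy : y ∈ degree n) :
    x * y ∈ degree (m + n) := by
  induction hx, hy using Submodule.span_induction₂ with
  | mem_mem x y hx hy =>
    obtain ⟨a, b, rfl, rfl⟩ := hx
    obtain ⟨a', b', rfl, rfl⟩ := hy
    exact Submodule.subset_span ⟨a + a', b + b', by push_cast; ring, by ring⟩
  | zero_left => simp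
  | zero_right => simp
  | add_left x y z _ _ _ h h' => rw [add_mul]; exact add_mem h h'
  | add_right x y z _ _ _ h h' => rw [mul_add]; exact add_mem h h'
  | smul_left r x y _ _ h => rw [smul_mul_assoc]; exact Submodule.smul_mem _ _ h
  | smul_right r x y _ _ h => rw [mul_smul_comm]; exact Submodule.smul_mem _ _ h

theorem one_mem_degree : (1 : Alg) ∈ degree 0 := Submodule.subset_span ⟨0, 0, by simp, by simp⟩

theorem q_mem_degree : q ∈ degree 0 := Submodule.subset_span ⟨1, 0, by simp, by simp⟩

theorem r_mem_degree : r ∈ degree (-1) := Submodule.subset_span ⟨0, 1, by simp, by simp⟩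

end DualPoly

/-! ### Retractions and the induced isomorphism on cohomology -/

namespace GradedSym

variable {V₁ V₀ : Type*} [AddCommGroup V₁] [Module ℂ V₁] [AddCommGroup V₀] [Module ℂ V₀]

/-- Anticommutativity only gives that twice the square vanishes; `2` is invertible in `ℂ`. -/
theorem odd_mul_self (f : V₁) : odd V₁ V₀ f * odd V₁ V₀ f = 0 := by
  have h : (2 : ℂ) • (odd V₁ V₀ f * odd V₁ V₀ f) = 0 := by
    rw [two_smul]
    exact add_eq_zero_iff_eq_neg.2 (odd_mul_odd f f)
  exact (smul_eq_zero.1 h).resolve_left two_ne_zero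

/-- A strong deformation retraction of the two-term complex `δ : V₁ → V₀` onto `0 : ℂ → ℂ`. -/
structure Retraction (δ : V₁ →ₗ[ℂ] V₀) where
  /-- The projection in degree `-1`. -/
  p₁ : V₁ →ₗ[ℂ] ℂ
  /-- The projection in degree `0`. -/
  p₀ : V₀ →ₗ[ℂ] ℂ
  /-- The inclusion of `1` in degree `-1`. -/
  i₁ : V₁
  /-- The inclusion of `1` in degree `0`. -/
  i₀ : V₀
  /-- The contracting homotopy. -/
  G : V₀ →ₗ[ℂ] V₁
  p₀_δ : ∀ f, p₀ (δ f) = 0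
  δ_i₁ : δ i₁ = 0
  p₁_i₁ : p₁ i₁ = 1
  p₀_i₀ : p₀ i₀ = 1
  δ_G : ∀ g, δ (G g) = g - p₀ g • i₀
  G_δ : ∀ f, G (δ f) = f - p₁ f • i₁

namespace Retraction

variable {δ : V₁ →ₗ[ℂ] V₀} (R : Retraction δ)

/-- `G i₀` itself need not vanish; the Euler operator only sees `δ (G i₀)`. -/
theorem δ_G_i₀ : δ (R.G R.i₀) = 0 := by rw [R.δ_G, R.p₀_i₀, one_smul, sub_self]

/-- The algebra homomorphism `Sym → ℂ[q, r]/(r²)` induced by the projections. -/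
noncomputable def proj : Sym V₁ V₀ →ₐ[ℂ] DualPoly.Alg :=
  lift (R.p₁.smulRight DualPoly.r) (R.p₀.smulRight DualPoly.q)
    (fun _ _ => mul_comm _ _) (fun _ _ => mul_comm _ _)
    (by
      intro f f'
      change (R.p₁ f • DualPoly.r) * (R.p₁ f' • DualPoly.r)
        = -((R.p₁ f' • DualPoly.r) * (R.p₁ f • DualPoly.r))
      simp only [smul_mul_smul_comm, DualPoly.r_mul_r, smul_zero, neg_zero])

theorem proj_odd (f : V₁) : R.proj (odd V₁ V₀ f) = R.p₁ f • DualPoly.r := lift_odd ..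

theorem proj_even (g : V₀) : R.proj (even V₁ V₀ g) = R.p₀ g • DualPoly.q := lift_even ..

theorem proj_differential (x : Sym V₁ V₀) : R.proj (differential δ x) = 0 := by
  induction x using GradedSym.induction with
  | hr r => simp [differential_algebraMap]
  | hodd f => simp [differential_odd, R.proj_even, R.p₀_δ]
  | heven g => simp [differential_even]
  | hmul x y hx hy => simp [differential_mul, hx, hy]
  | hadd x y hx hy => simp [hx, hy]

theorem exists_incl : ∃ σ : DualPoly.Alg →ₐ[ℂ] Sym V₁ V₀,
    σ DualPoly.q = even V₁ V₀ R.i₀ ∧ σ DualPoly.r = odd V₁ V₀ R.i₁ :=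
  DualPoly.exists_algHom _ _ (odd_mul_even _ _).symm (odd_mul_self R.i₁)

/-- The algebra homomorphism `ℂ[q, r]/(r²) → Sym` induced by the inclusions. -/
noncomputable def incl : DualPoly.Alg →ₐ[ℂ] Sym V₁ V₀ := R.exists_incl.choose

theorem incl_q : R.incl DualPoly.q = even V₁ V₀ R.i₀ := R.exists_incl.choose_spec.1

theorem incl_r : R.incl DualPoly.r = odd V₁ V₀ R.i₁ := R.exists_incl.choose_spec.2

theorem proj_incl (z : DualPoly.Alg) : R.proj (R.incl z) = z := by
  have h : R.proj.comp R.incl = AlgHom.id ℂ _ := DualPoly.algHom_ext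
    (by simp [incl_q, proj_even, p₀_i₀]) (by simp [incl_r, proj_odd, p₁_i₁])
  exact DFunLike.congr_fun h z

theorem incl_proj_odd (f : V₁) : R.incl (R.proj (odd V₁ V₀ f)) = R.p₁ f • odd V₁ V₀ R.i₁ := by
  rw [proj_odd, map_smul, incl_r]

theorem incl_proj_even (g : V₀) :
    R.incl (R.proj (even V₁ V₀ g)) = R.p₀ g • even V₁ V₀ R.i₀ := by
  rw [proj_even, map_smul, incl_q]

/-- Phrased with `incl (proj x)` so that induction on the generators of `Sym` applies; every `z` has
this form since `proj (incl z) = z`. -/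
theorem differential_incl_proj (x : Sym V₁ V₀) : differential δ (R.incl (R.proj x)) = 0 := by
  induction x using GradedSym.induction with
  | hr r => rw [AlgHom.commutes, AlgHom.commutes, differential_algebraMap]
  | hodd f => rw [incl_proj_odd, map_smul, differential_odd, R.δ_i₁, map_zero, smul_zero]
  | heven g => rw [incl_proj_even, map_smul, differential_even, smul_zero]
  | hmul x y hx hy => simp [differential_mul, hx, hy]
  | hadd x y hx hy => simp [hx, hy]

theorem differential_incl (z : DualPoly.Alg) : differential δ (R.incl z) = 0 := by
  rw [← R.proj_incl z, R.differential_incl_proj]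

theorem euler_incl_proj (x : Sym V₁ V₀) : euler δ R.G (R.incl (R.proj x)) = 0 := by
  induction x using GradedSym.induction with
  | hr r => rw [AlgHom.commutes, AlgHom.commutes, euler_algebraMap]
  | hodd f => rw [incl_proj_odd, map_smul, euler_odd, R.δ_i₁, map_zero, map_zero, smul_zero]
  | heven g => rw [incl_proj_even, map_smul, euler_even, R.δ_G_i₀, map_zero, smul_zero]
  | hmul x y hx hy => rw [map_mul, map_mul, euler_mul, hx, hy, zero_mul, mul_zero, add_zero]
  | hadd x y hx hy => rw [map_add, map_add, map_add, hx, hy, add_zero]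

/-- On a generator the difference is an eigenvector of eigenvalue `1`, because `G δ` and `δ G` are
the identity minus the retract. For products, split each factor into a part killed by the Euler
operator and a positive part: every term of the difference has at least one positive factor. -/
theorem sub_incl_proj_mem_positivePart (x : Sym V₁ V₀) :
    x - R.incl (R.proj x) ∈ positivePart δ R.G := by
  induction x using GradedSym.induction with
  | hr r => rw [AlgHom.commutes, AlgHom.commutes, sub_self]; exact zero_mem _
  | hodd f =>
    refine mem_positivePart 0 ?_
    rw [map_sub, euler_incl_proj, euler_odd, R.G_δ, incl_proj_odd]
    simp
  | heven g =>
    refine mem_positivePart 0 ?_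
    rw [map_sub, euler_incl_proj, euler_even, R.δ_G, incl_proj_even]
    simp
  | hmul x y hx hy =>
    have h : x * y - R.incl (R.proj (x * y))
        = (x - R.incl (R.proj x)) * (y - R.incl (R.proj y))
          + R.incl (R.proj x) * (y - R.incl (R.proj y))
          + (x - R.incl (R.proj x)) * R.incl (R.proj y) := by
      rw [map_mul, map_mul]
      noncomm_ring
    rw [h]
    exact add_mem (add_mem (mul_mem_positivePart hx hy)
      (mul_mem_positivePart_left (R.euler_incl_proj x) hy))
      (mul_mem_positivePart_right hx (R.euler_incl_proj y))
  | hadd x y hx hy =>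
    rw [map_add, map_add, add_sub_add_comm]
    exact add_mem hx hy

theorem exists_differential_eq {x : Sym V₁ V₀} (hx : differential δ x = 0)
    (hpx : R.proj x = 0) : ∃ y, differential δ y = x := by
  have h := R.sub_incl_proj_mem_positivePart x
  rw [hpx, map_zero, sub_zero] at h
  obtain ⟨p, hp, hpe⟩ := exists_aeval_euler_of_mem_positivePart h
  exact exists_differential_eq_of_aeval_euler δ R.G hx hp hpe

/-- The algebra homomorphism induced by `proj` on cohomology. -/
noncomputable def cohomologyHom : Cohomology δ →ₐ[ℂ] DualPoly.Alg :=
  Ideal.Quotient.liftₐ (coboundaries δ) (R.proj.comp (cocycles δ).val) (by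
    rintro ⟨x, hx⟩ ⟨y, hy⟩
    change R.proj x = 0
    rw [← show differential δ y = x from hy, proj_differential])

theorem cohomologyHom_bijective : Function.Bijective R.cohomologyHom := by
  constructor
  · rw [injective_iff_map_eq_zero]
    intro z hz
    obtain ⟨x, rfl⟩ := Ideal.Quotient.mk_surjective z
    exact Ideal.Quotient.eq_zero_iff_mem.2 (R.exists_differential_eq x.2 hz)
  · intro z
    exact ⟨cohomologyClass δ ⟨R.incl z, R.differential_incl z⟩, R.proj_incl z⟩

/-- The cohomology of `Sym` is `ℂ[q, r]/(r²)`. -/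
noncomputable def cohomologyEquiv : Cohomology δ ≃ₐ[ℂ] DualPoly.Alg :=
  AlgEquiv.ofBijective R.cohomologyHom R.cohomologyHom_bijective

theorem cohomologyEquiv_evenClass (g : V₀) :
    R.cohomologyEquiv (evenClass δ g) = R.p₀ g • DualPoly.q := R.proj_even g

theorem cohomologyEquiv_oddClass (f : LinearMap.ker δ) :
    R.cohomologyEquiv (oddClass δ f) = R.p₁ f • DualPoly.r := R.proj_odd f

theorem proj_mem_degree {n : ℤ} {x : Sym V₁ V₀} (hx : x ∈ degree V₁ V₀ n) :
    R.proj x ∈ DualPoly.degree n := by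
  induction hx using Submodule.span_induction with
  | mem x hx =>
    obtain ⟨fs, gs, rfl, rfl⟩ := hx
    have hgs : R.proj (gs.map (even V₁ V₀)).prod ∈ DualPoly.degree 0 := by
      induction gs with
      | nil => simpa using DualPoly.one_mem_degree
      | cons g gs ih =>
        rw [List.map_cons, List.prod_cons, map_mul, proj_even]
        simpa using DualPoly.mul_mem_degree
          (Submodule.smul_mem _ (R.p₀ g) DualPoly.q_mem_degree) ih
    induction fs with
    | nil => simpa using hgs
    | cons f fs ih =>
      rw [List.map_cons, List.prod_cons, mul_assoc, map_mul, proj_odd]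
      have := DualPoly.mul_mem_degree (Submodule.smul_mem _ (R.p₁ f) DualPoly.r_mem_degree) ih
      convert this using 2
      push_cast [List.length_cons]
      ring
  | zero => simp
  | add x y _ _ h h' => rw [map_add]; exact add_mem h h'
  | smul r x _ h => rw [map_smul]; exact Submodule.smul_mem _ _ h

theorem incl_mem_degree {n : ℤ} {z : DualPoly.Alg} (hz : z ∈ DualPoly.degree n) :
    R.incl z ∈ degree V₁ V₀ n := by
  induction hz using Submodule.span_induction with
  | mem z hz =>
    obtain ⟨a, b, rfl, rfl⟩ := hz
    refine Submodule.subset_span ⟨List.replicate b R.i₁, List.replicate a R.i₀, by simp, ?_⟩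
    rw [mul_comm, map_mul, map_pow, map_pow, incl_q, incl_r]
    simp
  | zero => simp
  | add x y _ _ h h' => rw [map_add]; exact add_mem h h'
  | smul r x _ h => rw [map_smul]; exact Submodule.smul_mem _ _ h

/-- `proj` and `incl` both preserve degrees; `incl` supplies a homogeneous cocycle above each
homogeneous `z`. -/
theorem map_cohomologyDegree (n : ℤ) :
    (cohomologyDegree δ n).map R.cohomologyEquiv.toLinearMap = DualPoly.degree n := by
  apply le_antisymm
  · rintro _ ⟨_, ⟨x, hx, rfl⟩, rfl⟩
    exact R.proj_mem_degree hx
  · intro z hz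
    exact ⟨_, ⟨⟨R.incl z, R.differential_incl z⟩, R.incl_mem_degree hz, rfl⟩, R.proj_incl z⟩

end Retraction

/-- A two-term complex with one-dimensional cohomology in both degrees, detected by `p₁` and `p₀`,
retracts onto `0 : ℂ → ℂ`. -/
theorem exists_retraction {δ : V₁ →ₗ[ℂ] V₀} {p₁ : V₁ →ₗ[ℂ] ℂ} {p₀ : V₀ →ₗ[ℂ] ℂ} {i₁ : V₁} {i₀ : V₀}
    (hi₁ : p₁ i₁ = 1) (hi₀ : p₀ i₀ = 1) (hδi₁ : δ i₁ = 0)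
    (hker : ∀ f, δ f = 0 → p₁ f = 0 → f = 0) (hrange : ∀ g, (∃ f, δ f = g) ↔ p₀ g = 0) :
    ∃ R : Retraction δ, R.p₁ = p₁ ∧ R.p₀ = p₀ := by
  -- `δ` restricts to a bijection from `ker p₁` to `ker p₀`. The homotopy is its inverse,
  -- precomposed with the projection `π` along `i₀`.
  let δ' : LinearMap.ker p₁ →ₗ[ℂ] LinearMap.ker p₀ :=
    δ.restrict fun f _ => (hrange _).1 ⟨f, rfl⟩
  have hδ' : ∀ f, (δ' f : V₀) = δ f := fun _ => rfl
  have hbij : Function.Bijective δ' := by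
    constructor
    · rw [injective_iff_map_eq_zero]
      intro f hf
      exact Subtype.ext (hker f (congrArg Subtype.val hf) f.2)
    · rintro ⟨g, hg⟩
      obtain ⟨f, rfl⟩ := (hrange g).2 hg
      -- Subtracting a multiple of `i₁` moves `f` into `ker p₁` without changing `δ f`.
      refine ⟨⟨f - p₁ f • i₁, by simp [hi₁]⟩, Subtype.ext ?_⟩
      rw [hδ', map_sub, map_smul, hδi₁, smul_zero, sub_zero]
  let e := LinearEquiv.ofBijective δ' hbij
  let π : V₀ →ₗ[ℂ] LinearMap.ker p₀ :=
    (LinearMap.id - p₀.smulRight i₀).codRestrict _ (by simp [hi₀])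
  have hπ : ∀ g, (π g : V₀) = g - p₀ g • i₀ := fun _ => rfl
  refine ⟨⟨p₁, p₀, i₁, i₀, (LinearMap.ker p₁).subtype ∘ₗ e.symm.toLinearMap ∘ₗ π,
    fun f => (hrange _).1 ⟨f, rfl⟩, hδi₁, hi₁, hi₀, fun g => ?_, fun f => ?_⟩, rfl, rfl⟩
  · rw [← hπ, ← e.apply_symm_apply (π g)]
    simp only [LinearMap.comp_apply]
    rw [e.apply_symm_apply]
    exact congrArg Subtype.val (e.apply_symm_apply (π g))
  · have h : π (δ f) = e ⟨f - p₁ f • i₁, by simp [hi₁]⟩ := by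
      apply Subtype.ext
      change _ = δ (f - p₁ f • i₁)
      rw [hπ, (hrange _).1 ⟨f, rfl⟩, map_sub, map_smul, hδi₁]
      simp
    simp only [LinearMap.comp_apply, LinearEquiv.coe_coe, h, e.symm_apply_apply]
    rfl

end GradedSym

/-! ### Descent and directional derivatives on the torus -/

namespace Torus

open MeasureTheory UnitAddTorus

variable {d : ℕ} {L : ℝ}

theorem proj_add (x y : EuclideanSpace ℝ (Fin d)) :
    proj d L (x + y) = proj d L x + proj d L y := by
  funext i
  simp [proj]

theorem isQuotientMap_proj : Topology.IsQuotientMap (proj d L) := by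
  have h : IsOpenQuotientMap (Pi.map fun (_ : Fin d) (x : ℝ) => (x : AddCircle L)) :=
    IsOpenQuotientMap.piMap fun _ => QuotientAddGroup.isOpenQuotientMap_mk
  exact (h.comp (EuclideanSpace.equiv (Fin d) ℝ).toHomeomorph.isOpenQuotientMap).isQuotientMap

theorem continuous_smooth (f : Smooth d L) : Continuous (f : Torus d L → ℂ) :=
  isQuotientMap_proj.continuous_iff.2 (contDiff_pullback f).continuous

/-- The smooth function on the torus with a given smooth periodic pullback. -/
noncomputable def descend (F : EuclideanSpace ℝ (Fin d) → ℂ) (hF : ContDiff ℝ (⊤ : ℕ∞) F)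
    (h : ∀ x y, proj d L x = proj d L y → F x = F y) : Smooth d L :=
  ⟨fun t => F (Function.surjInv (proj_surjective d L) t), by
    have e : (fun t => F (Function.surjInv (proj_surjective d L) t)) ∘ proj d L = F :=
      funext fun x => h _ _ (Function.surjInv_eq (proj_surjective d L) (proj d L x))
    change ContDiff ℝ (⊤ : ℕ∞) _
    rwa [e]⟩

theorem pullback_descend (F : EuclideanSpace ℝ (Fin d) → ℂ) (hF : ContDiff ℝ (⊤ : ℕ∞) F)
    (h : ∀ x y, proj d L x = proj d L y → F x = F y) : pullback (descend F hF h) = F :=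
  funext fun x => h _ _ (Function.surjInv_eq (proj_surjective d L) (proj d L x))

/-- The directional derivative of a smooth function on the torus. -/
noncomputable def dirDeriv (v : EuclideanSpace ℝ (Fin d)) (f : Smooth d L) : Smooth d L :=
  descend (fun x => fderiv ℝ (pullback f) x v)
    (((contDiff_pullback f).fderiv_right (by decide)).clm_apply contDiff_const) (by
      intro x y h
      have hp : (fun z => pullback f (z + (y - x))) = pullback f := by
        funext z
        simp only [pullback, Function.comp_apply, proj_add_of_proj_eq h]
      have h2 : fderiv ℝ (pullback f) x = fderiv ℝ (pullback f) y := by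
        conv_lhs => rw [← hp]
        rw [fderiv_comp_add_right]
        simp
      rw [h2])

theorem pullback_dirDeriv (v : EuclideanSpace ℝ (Fin d)) (f : Smooth d L)
    (x : EuclideanSpace ℝ (Fin d)) : pullback (dirDeriv v f) x = fderiv ℝ (pullback f) x v :=
  congrFun (pullback_descend _ _ _) x

theorem differentiable_fderiv_pullback (f : Smooth d L) :
    Differentiable ℝ (fderiv ℝ (pullback f)) :=
  ((contDiff_pullback f).fderiv_right (m := 1) (by decide)).differentiable (by simp)

theorem pullback_sum (s : Finset (Fin d)) (g : Fin d → Smooth d L)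
    (x : EuclideanSpace ℝ (Fin d)) : pullback (∑ i ∈ s, g i) x = ∑ i ∈ s, pullback (g i) x := by
  simp [pullback]

/-- Reduces the action of the Laplacian on Fourier series and coefficients to that of first-order
derivatives. -/
theorem lap_eq_sum (f : Smooth d L) :
    lap f = ∑ i, dirDeriv (EuclideanSpace.single i 1) (dirDeriv (EuclideanSpace.single i 1) f) := by
  apply pullback_injective
  rw [pullback_lap]
  funext x
  rw [InnerProductSpace.laplacian_eq_iteratedFDeriv_orthonormalBasis _
    (EuclideanSpace.basisFun (Fin d) ℝ), pullback_sum]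
  refine Finset.sum_congr rfl fun i _ => ?_
  have hd : pullback (dirDeriv (EuclideanSpace.single i 1) f)
      = fun y => fderiv ℝ (pullback f) y (EuclideanSpace.single i 1) :=
    funext (pullback_dirDeriv _ f)
  rw [pullback_dirDeriv, hd, iteratedFDeriv_two_apply,
    fderiv_clm_apply (differentiable_fderiv_pullback f x) (differentiableAt_const _)]
  simp

/-! ### Fourier modes -/

/-- The covering map `ℝ^d → (ℝ/ℤ)^d` rescaled to have the periods of `T^d`. -/
noncomputable def unitProj (L : ℝ) (x : EuclideanSpace ℝ (Fin d)) : UnitAddTorus (Fin d) :=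
  fun i => ((x i / L : ℝ) : UnitAddCircle)

/-- The frequency vector of the `n`-th Fourier mode, as a linear form. -/
noncomputable def freq (L : ℝ) (n : Fin d → ℤ) : EuclideanSpace ℝ (Fin d) →L[ℝ] ℂ :=
  ∑ i, (2 * Real.pi * Complex.I * n i / L : ℂ) •
    (Complex.ofRealCLM.comp (EuclideanSpace.proj i : EuclideanSpace ℝ (Fin d) →L[ℝ] ℝ))

theorem freq_apply (n : Fin d → ℤ) (x : EuclideanSpace ℝ (Fin d)) :
    freq L n x = ∑ i, 2 * Real.pi * Complex.I * n i / L * x i := by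
  simp [freq]

theorem freq_single (n : Fin d → ℤ) (i : Fin d) :
    freq L n (EuclideanSpace.single i 1) = 2 * Real.pi * Complex.I * n i / L := by
  rw [freq_apply, Finset.sum_eq_single i] <;> simp +contextual

theorem mFourier_unitProj (n : Fin d → ℤ) (x : EuclideanSpace ℝ (Fin d)) :
    mFourier n (unitProj L x) = Complex.exp (freq L n x) := by
  rw [freq_apply, Complex.exp_sum]
  change ∏ i, fourier (n i) (unitProj L x i) = _
  refine Finset.prod_congr rfl fun i _ => ?_
  rw [unitProj, fourier_coe_apply]
  congr 1
  push_cast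
  ring

theorem norm_exp_freq (n : Fin d → ℤ) (x : EuclideanSpace ℝ (Fin d)) :
    ‖Complex.exp (freq L n x)‖ = 1 := by
  rw [Complex.norm_exp, freq_apply, Complex.re_sum, Finset.sum_eq_zero, Real.exp_zero]
  intro i _
  have : (2 * Real.pi * Complex.I * n i / L * x i : ℂ)
      = ((2 * Real.pi * n i / L * x i : ℝ) : ℂ) * Complex.I := by
    push_cast
    ring
  rw [this, Complex.re_ofReal_mul, Complex.I_re, mul_zero]

theorem hasFDerivAt_exp_freq (n : Fin d → ℤ) (x : EuclideanSpace ℝ (Fin d)) :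
    HasFDerivAt (fun x => Complex.exp (freq L n x)) (Complex.exp (freq L n x) • freq L n) x :=
  (freq L n).hasFDerivAt.cexp

/-- A bound for the norms of the linear forms `freq L n`. -/
noncomputable def freqBound (d : ℕ) (L : ℝ) : ℝ :=
  ∑ _i : Fin d, |2 * Real.pi / L|

theorem norm_freq_apply_le (n : Fin d → ℤ) (x : EuclideanSpace ℝ (Fin d)) :
    ‖freq L n x‖ ≤ freqBound d L * ‖n‖ * ‖x‖ := by
  rw [freq_apply, freqBound, Finset.sum_mul, Finset.sum_mul]
  refine (norm_sum_le _ _).trans (Finset.sum_le_sum fun i _ => ?_)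
  have e : (2 * Real.pi * Complex.I * n i / L * x i : ℂ)
      = ((2 * Real.pi / L : ℝ) : ℂ) * Complex.I * ((n i : ℝ) : ℂ) * (x i : ℂ) := by
    push_cast
    ring
  rw [e]
  simp only [norm_mul, Complex.norm_I, Complex.norm_real, mul_one]
  have h1 : ‖(n i : ℝ)‖ ≤ ‖n‖ := norm_le_pi_norm n i
  have h2 : ‖x i‖ ≤ ‖x‖ := PiLp.norm_apply_le x i
  rw [← Real.norm_eq_abs]
  gcongr

theorem norm_freq_le (n : Fin d → ℤ) : ‖freq L n‖ ≤ freqBound d L * ‖n‖ :=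
  (freq L n).opNorm_le_bound
    (mul_nonneg (Finset.sum_nonneg fun _ _ => abs_nonneg _) (norm_nonneg _)) (norm_freq_apply_le n)

/-! ### Fourier series with rapidly decreasing coefficients -/

/-- Rapidly decreasing families of Fourier coefficients. -/
def RapidDecay (b : (Fin d → ℤ) → ℂ) : Prop :=
  ∀ k : ℕ, Summable fun n => ‖n‖ ^ k * ‖b n‖

theorem RapidDecay.summable {b : (Fin d → ℤ) → ℂ} (hb : RapidDecay b) : Summable b :=
  Summable.of_norm (by simpa using hb 0)

/-- A factor of polynomial growth is absorbed by raising the exponent of the weight. -/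
theorem RapidDecay.of_le {b c : (Fin d → ℤ) → ℂ} (hb : RapidDecay b) (C : ℝ) (k : ℕ)
    (h : ∀ n, ‖c n‖ ≤ C * ‖n‖ ^ k * ‖b n‖) : RapidDecay c := by
  intro m
  refine Summable.of_nonneg_of_le (fun n => by positivity) (fun n => ?_) ((hb (m + k)).mul_left C)
  calc ‖n‖ ^ m * ‖c n‖ ≤ ‖n‖ ^ m * (C * ‖n‖ ^ k * ‖b n‖) := by gcongr; exact h n
    _ = C * (‖n‖ ^ (m + k) * ‖b n‖) := by ring

theorem RapidDecay.mul_freq {b : (Fin d → ℤ) → ℂ} (hb : RapidDecay b) (L : ℝ)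
    (v : EuclideanSpace ℝ (Fin d)) : RapidDecay fun n => b n * freq L n v :=
  hb.of_le (freqBound d L * ‖v‖) 1 fun n => by
    rw [norm_mul]
    calc ‖b n‖ * ‖freq L n v‖ ≤ ‖b n‖ * (freqBound d L * ‖n‖ * ‖v‖) := by
          gcongr; exact norm_freq_apply_le n v
      _ = _ := by ring

theorem RapidDecay.summable_series {b : (Fin d → ℤ) → ℂ} (hb : RapidDecay b)
    (x : EuclideanSpace ℝ (Fin d)) : Summable fun n => b n * Complex.exp (freq L n x) :=
  Summable.of_norm (by simpa [norm_exp_freq] using hb 0)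

/-- The sum of the Fourier series with coefficients `b`. -/
noncomputable def series (L : ℝ) (b : (Fin d → ℤ) → ℂ) (x : EuclideanSpace ℝ (Fin d)) : ℂ :=
  ∑' n, b n * Complex.exp (freq L n x)

/-- Termwise differentiation: the derivatives of the terms are bounded, uniformly in `x`, by a
summable multiple of `‖n‖ * ‖b n‖`. Their summability is recorded so that evaluation at a vector can
pass through the sum. -/
theorem RapidDecay.hasFDerivAt_series {b : (Fin d → ℤ) → ℂ} (hb : RapidDecay b)
    (x : EuclideanSpace ℝ (Fin d)) :
    HasFDerivAt (series L b) (∑' n, b n • (Complex.exp (freq L n x) • freq L n)) x ∧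
      Summable fun n => b n • (Complex.exp (freq L n x) • freq L n) := by
  have hu : Summable fun n => freqBound d L * (‖n‖ ^ 1 * ‖b n‖) := (hb 1).mul_left _
  have hbound : ∀ n (x : EuclideanSpace ℝ (Fin d)),
      ‖b n • (Complex.exp (freq L n x) • freq L n)‖ ≤ freqBound d L * (‖n‖ ^ 1 * ‖b n‖) := by
    intro n x
    rw [norm_smul, norm_smul, norm_exp_freq, one_mul]
    calc ‖b n‖ * ‖freq L n‖ ≤ ‖b n‖ * (freqBound d L * ‖n‖) := by gcongr; exact norm_freq_le n
      _ = _ := by ring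
  exact ⟨hasFDerivAt_tsum hu (fun n x => (hasFDerivAt_exp_freq n x).const_mul (b n)) hbound
    (hb.summable_series 0) x, Summable.of_norm_bounded hu fun n => hbound n x⟩

theorem RapidDecay.fderiv_series {b : (Fin d → ℤ) → ℂ} (hb : RapidDecay b)
    (v : EuclideanSpace ℝ (Fin d)) :
    (fun x => fderiv ℝ (series L b) x v) = series L fun n => b n * freq L n v := by
  funext x
  obtain ⟨h, hs⟩ := hb.hasFDerivAt_series (L := L) x
  rw [h.fderiv]
  refine ((ContinuousLinearMap.apply ℝ ℂ v).map_tsum hs).trans (tsum_congr fun n => ?_)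
  simp only [ContinuousLinearMap.apply_apply, smul_apply, smul_eq_mul]
  ring

/-- Directional derivatives of such a series are again such series, so the induction on the order of
smoothness runs over all `b` at once. -/
theorem RapidDecay.contDiff_series {b : (Fin d → ℤ) → ℂ} (hb : RapidDecay b) :
    ContDiff ℝ (⊤ : ℕ∞) (series L b) := by
  rw [contDiff_infty]
  intro k
  induction k generalizing b with
  | zero =>
    exact contDiff_zero.2 (continuous_iff_continuousAt.2 fun x =>
      (hb.hasFDerivAt_series x).1.continuousAt)
  | succ k ih =>
    push_cast
    rw [contDiff_succ_iff_fderiv_apply]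
    refine ⟨fun x => (hb.hasFDerivAt_series x).1.differentiableAt, by simp, fun v => ?_⟩
    rw [hb.fderiv_series]
    exact ih (hb.mul_freq L v)

/-! ### Eigenvalues of the Laplacian and their lower bound -/

/-- The eigenvalue of the Laplacian on the `n`-th Fourier mode. -/
noncomputable def eigenvalue (L : ℝ) (n : Fin d → ℤ) : ℂ :=
  ∑ i, (2 * Real.pi * Complex.I * n i / L) ^ 2

theorem eigenvalue_eq (n : Fin d → ℤ) :
    eigenvalue L n = -(((2 * Real.pi / L) ^ 2 * ∑ i, (n i : ℝ) ^ 2 : ℝ) : ℂ) := by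
  rw [eigenvalue]
  push_cast
  rw [Finset.mul_sum, ← Finset.sum_neg_distrib]
  refine Finset.sum_congr rfl fun i _ => ?_
  have := Complex.I_sq
  ring_nf
  rw [this]
  ring

/-- The norm on `ℤ^d` is the sup norm, which is at most the Euclidean one. -/
theorem le_norm_eigenvalue (n : Fin d → ℤ) :
    (2 * Real.pi / L) ^ 2 * ‖n‖ ^ 2 ≤ ‖eigenvalue L n‖ := by
  rw [eigenvalue_eq, norm_neg, Complex.norm_real, Real.norm_of_nonneg (by positivity)]
  gcongr
  rw [← Real.le_sqrt (norm_nonneg _) (by positivity), pi_norm_le_iff_of_nonneg (Real.sqrt_nonneg _)]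
  intro i
  rw [Real.le_sqrt (norm_nonneg _) (by positivity), Int.norm_eq_abs, sq_abs]
  exact Finset.single_le_sum (f := fun i => (n i : ℝ) ^ 2) (fun i _ => sq_nonneg _)
    (Finset.mem_univ i)

theorem one_le_norm_of_ne_zero {n : Fin d → ℤ} (hn : n ≠ 0) : 1 ≤ ‖n‖ := by
  obtain ⟨i, hi⟩ := Function.ne_iff.1 hn
  refine le_trans ?_ (norm_le_pi_norm n i)
  rw [Int.norm_eq_abs]
  exact_mod_cast Int.one_le_abs hi

/-! ### Rescaling from the unit torus and the action on Fourier series -/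

variable [hL : Fact (0 < L)]

/-- The rescaling isomorphism `(ℝ/ℤ)^d ≃ (ℝ/Lℤ)^d`. -/
noncomputable def scale (d : ℕ) (L : ℝ) [hL : Fact (0 < L)] :
    UnitAddTorus (Fin d) ≃+ Torus d L :=
  AddEquiv.piCongrRight fun _ => AddCircle.equivAddCircle 1 L one_ne_zero hL.out.ne'

theorem scale_unitProj (x : EuclideanSpace ℝ (Fin d)) : scale d L (unitProj L x) = proj d L x := by
  funext i
  have h : AddCircle.equivAddCircle 1 L one_ne_zero hL.out.ne' ((x i / L : ℝ) : AddCircle (1 : ℝ))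
      = (x i : AddCircle L) := by
    rw [AddCircle.equivAddCircle_apply_mk, inv_one, one_mul, div_mul_cancel₀ _ hL.out.ne']
  exact h

theorem unitProj_eq (x : EuclideanSpace ℝ (Fin d)) :
    unitProj L x = (scale d L).symm (proj d L x) := by
  rw [← scale_unitProj, AddEquiv.symm_apply_apply]

theorem continuous_scale : Continuous (scale d L) :=
  continuous_pi fun i => (AddCircle.homeomorphAddCircle 1 L one_ne_zero hL.out.ne').continuous.comp
    (continuous_apply i)

/-- The smooth function on the torus with Fourier coefficients `b`. -/
noncomputable def ofCoeff (b : (Fin d → ℤ) → ℂ) (hb : RapidDecay b) : Smooth d L :=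
  descend (series L b) hb.contDiff_series fun x y h => by
    refine tsum_congr fun n => ?_
    rw [← mFourier_unitProj, ← mFourier_unitProj, unitProj_eq, unitProj_eq, h]

theorem pullback_ofCoeff (b : (Fin d → ℤ) → ℂ) (hb : RapidDecay b) :
    pullback (ofCoeff b hb : Smooth d L) = series L b := pullback_descend _ _ _

theorem dirDeriv_ofCoeff (v : EuclideanSpace ℝ (Fin d)) (b : (Fin d → ℤ) → ℂ) (hb : RapidDecay b) :
    dirDeriv v (ofCoeff b hb : Smooth d L) = ofCoeff _ (hb.mul_freq L v) := by
  apply pullback_injective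
  funext x
  rw [pullback_dirDeriv, pullback_ofCoeff, pullback_ofCoeff, ← hb.fderiv_series]

theorem pullback_lap_ofCoeff (b : (Fin d → ℤ) → ℂ) (hb : RapidDecay b) :
    pullback (lap (ofCoeff b hb : Smooth d L)) = series L fun n => eigenvalue L n * b n := by
  funext x
  rw [lap_eq_sum, pullback_sum]
  simp only [dirDeriv_ofCoeff, pullback_ofCoeff, series]
  rw [← Summable.tsum_finsetSum fun i _ => ((hb.mul_freq L _).mul_freq L _).summable_series x]
  refine tsum_congr fun n => ?_
  simp only [eigenvalue, Finset.sum_mul, freq_single]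
  refine Finset.sum_congr rfl fun i _ => ?_
  ring

theorem two_pi_div_pos : 0 < 2 * Real.pi / L := div_pos Real.two_pi_pos hL.out

theorem eigenvalue_ne_zero {n : Fin d → ℤ} (hn : n ≠ 0) : eigenvalue L n ≠ 0 := by
  have h1 := le_norm_eigenvalue (L := L) n
  have h2 := one_le_norm_of_ne_zero hn
  have h3 := two_pi_div_pos (L := L)
  have : 0 < ‖eigenvalue L n‖ := lt_of_lt_of_le (by positivity) h1
  exact norm_pos_iff.1 this

end Torus

/-! ### Differentiation along translations -/

namespace Torus

open MeasureTheory UnitAddTorus Filter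

variable {d : ℕ} {L : ℝ}

theorem hasDerivAt_pullback_line (f : Smooth d L) (x v : EuclideanSpace ℝ (Fin d)) (s : ℝ) :
    HasDerivAt (fun s : ℝ => pullback f (x + s • v)) (pullback (dirDeriv v f) (x + s • v)) s := by
  rw [pullback_dirDeriv]
  have h1 : HasDerivAt (fun s : ℝ => x + s • v) v s := by
    simpa using ((hasDerivAt_id s).smul_const v).const_add x
  exact (((contDiff_pullback f).differentiable (by simp)) _).hasFDerivAt.comp_hasDerivAt s h1

theorem hasDerivAt_translate (f : Smooth d L) (t : Torus d L) (v : EuclideanSpace ℝ (Fin d))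
    (s : ℝ) : HasDerivAt (fun s : ℝ => (f : Torus d L → ℂ) (t + proj d L (s • v)))
      ((dirDeriv v f : Torus d L → ℂ) (t + proj d L (s • v))) s := by
  obtain ⟨x, rfl⟩ := proj_surjective d L t
  simp only [← proj_add]
  exact hasDerivAt_pullback_line f x v s

variable [hL : Fact (0 < L)]

/-! ### Fourier coefficients of smooth functions -/

/-- The Haar probability measure on `(ℝ/ℤ)^d`. -/
noncomputable abbrev unitHaar (d : ℕ) : Measure (UnitAddTorus (Fin d)) :=
  Measure.pi fun _ => AddCircle.haarAddCircle

/-- The `n`-th Fourier coefficient of a function on `T^d`, for the normalized measure. -/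
noncomputable def coeff (f : Smooth d L) (n : Fin d → ℤ) : ℂ :=
  mFourierCoeff (fun t => (f : Torus d L → ℂ) (scale d L t)) n

theorem coeff_eq_integral (f : Smooth d L) (n : Fin d → ℤ) :
    coeff f n = ∫ t, mFourier (-n) t * (f : Torus d L → ℂ) (scale d L t) ∂unitHaar d := rfl

theorem mFourier_add_apply (n : Fin d → ℤ) (s t : UnitAddTorus (Fin d)) :
    mFourier n (s + t) = mFourier n s * mFourier n t := by
  change ∏ i, fourier (n i) (s i + t i) = (∏ i, fourier (n i) (s i)) * ∏ i, fourier (n i) (t i)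
  rw [← Finset.prod_mul_distrib]
  refine Finset.prod_congr rfl fun i _ => ?_
  simp [fourier_apply, AddCircle.toCircle_add]

theorem mFourier_mul_mFourier_neg (n : Fin d → ℤ) (t : UnitAddTorus (Fin d)) :
    mFourier n t * mFourier (-n) t = 1 := by
  rw [← mFourier_add, add_neg_cancel, mFourier_zero]
  rfl

theorem norm_mFourier_apply_le (n : Fin d → ℤ) (t : UnitAddTorus (Fin d)) :
    ‖mFourier n t‖ ≤ 1 :=
  ((mFourier n).norm_coe_le_norm t).trans_eq mFourier_norm

theorem exists_norm_le (f : Smooth d L) : ∃ C, ∀ t, ‖(f : Torus d L → ℂ) t‖ ≤ C := by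
  obtain ⟨C, hC⟩ := isCompact_univ.exists_bound_of_continuousOn (continuous_smooth f).continuousOn
  exact ⟨C, fun t => hC t (Set.mem_univ t)⟩

/-- Haar measure is translation invariant and the modes are characters, so translating `f`
multiplies its coefficient by a phase. -/
theorem integral_mFourier_mul_translate (f : Smooth d L) (n : Fin d → ℤ)
    (v : EuclideanSpace ℝ (Fin d)) :
    ∫ t, mFourier (-n) t * (f : Torus d L → ℂ) (scale d L t + proj d L v) ∂unitHaar d
      = Complex.exp (freq L n v) * coeff f n := by
  have h := integral_add_right_eq_self (μ := unitHaar d)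
    (fun t => mFourier (-n) t * (f : Torus d L → ℂ) (scale d L t)) (unitProj L v)
  rw [coeff_eq_integral, ← h, ← integral_const_mul]
  refine integral_congr_ae (Eventually.of_forall fun t => ?_)
  simp only
  rw [← mFourier_unitProj, mFourier_add_apply, map_add, scale_unitProj]
  linear_combination -(mFourier (-n) t * (f : Torus d L → ℂ) (scale d L t + proj d L v)) *
    mFourier_mul_mFourier_neg n (unitProj L v)

/-- In place of integration by parts, the translation formula along `s • v` is differentiated at `s
= 0`: under the integral on one side, where compactness gives a constant bound, and as an
exponential on the other. -/
theorem coeff_dirDeriv (v : EuclideanSpace ℝ (Fin d)) (f : Smooth d L) (n : Fin d → ℤ) :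
    coeff (dirDeriv v f) n = freq L n v * coeff f n := by
  obtain ⟨C, hC⟩ := exists_norm_le (dirDeriv v f)
  have hcont : ∀ (g : Smooth d L) (s : ℝ), Continuous fun t : UnitAddTorus (Fin d) =>
      mFourier (-n) t * (g : Torus d L → ℂ) (scale d L t + proj d L (s • v)) := fun g s =>
    (mFourier (-n)).continuous.mul
      ((continuous_smooth g).comp (continuous_scale.add continuous_const))
  have hint := (hasDerivAt_integral_of_dominated_loc_of_deriv_le (μ := unitHaar d)
    (F := fun (s : ℝ) t => mFourier (-n) t *
      (f : Torus d L → ℂ) (scale d L t + proj d L (s • v)))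
    (F' := fun (s : ℝ) t => mFourier (-n) t *
      (dirDeriv v f : Torus d L → ℂ) (scale d L t + proj d L (s • v)))
    (x₀ := 0) (bound := fun _ => C) univ_mem
    (Eventually.of_forall fun s => (hcont f s).aestronglyMeasurable)
    ((hcont f 0).integrable_of_hasCompactSupport (HasCompactSupport.of_compactSpace _))
    (hcont _ 0).aestronglyMeasurable
    (Eventually.of_forall fun t s _ => by
      rw [norm_mul]
      exact (mul_le_of_le_one_left (norm_nonneg _) (norm_mFourier_apply_le _ _)).trans (hC _))
    (integrable_const C)
    (Eventually.of_forall fun t s _ => (hasDerivAt_translate f _ v s).const_mul _)).2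
  have hexp : HasDerivAt (fun s : ℝ => Complex.exp (freq L n (s • v)) * coeff f n)
      (freq L n v * coeff f n) 0 := by
    have h1 : HasDerivAt (fun s : ℝ => freq L n (s • v)) (freq L n v) 0 := by
      have h2 : HasDerivAt (fun s : ℝ => s • freq L n v) ((1 : ℝ) • freq L n v) 0 :=
        (hasDerivAt_id (0 : ℝ)).smul_const _
      simpa using h2
    simpa using h1.cexp.mul_const (coeff f n)
  simp only [integral_mFourier_mul_translate] at hint
  simpa using hint.unique hexp

theorem integrable_mFourier_mul (f : Smooth d L) (n : Fin d → ℤ) :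
    Integrable (fun t => mFourier (-n) t * (f : Torus d L → ℂ) (scale d L t)) (unitHaar d) :=
  ((mFourier (-n)).continuous.mul
    ((continuous_smooth f).comp continuous_scale)).integrable_of_hasCompactSupport
    (HasCompactSupport.of_compactSpace _)

/-- The `n`-th Fourier coefficient as a linear form. -/
noncomputable def coeffₗ (n : Fin d → ℤ) : Smooth d L →ₗ[ℂ] ℂ where
  toFun f := coeff f n
  map_add' f g := by
    rw [coeff_eq_integral, coeff_eq_integral, coeff_eq_integral,
      ← integral_add (integrable_mFourier_mul f n) (integrable_mFourier_mul g n)]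
    refine integral_congr_ae (Eventually.of_forall fun t => ?_)
    exact mul_add _ _ _
  map_smul' c f := by
    rw [coeff_eq_integral, coeff_eq_integral, RingHom.id_apply, smul_eq_mul, ← integral_const_mul]
    refine integral_congr_ae (Eventually.of_forall fun t => ?_)
    exact mul_left_comm _ _ _

theorem coeffₗ_apply (n : Fin d → ℤ) (f : Smooth d L) : coeffₗ n f = coeff f n := rfl

theorem coeff_lap (f : Smooth d L) (n : Fin d → ℤ) :
    coeff (lap f) n = eigenvalue L n * coeff f n := by
  rw [lap_eq_sum, ← coeffₗ_apply, map_sum, eigenvalue, Finset.sum_mul]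
  refine Finset.sum_congr rfl fun i _ => ?_
  rw [coeffₗ_apply, coeff_dirDeriv, coeff_dirDeriv, freq_single]
  ring

theorem coeff_lap_iterate (f : Smooth d L) (n : Fin d → ℤ) (k : ℕ) :
    coeff (lap^[k] f) n = eigenvalue L n ^ k * coeff f n := by
  induction k with
  | zero => simp
  | succ k ih => rw [Function.iterate_succ_apply', coeff_lap, ih, pow_succ', mul_assoc]

theorem exists_norm_coeff_le (f : Smooth d L) : ∃ C, ∀ n, ‖coeff f n‖ ≤ C := by
  obtain ⟨C, hC⟩ := exists_norm_le f
  refine ⟨C, fun n => ?_⟩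
  rw [coeff_eq_integral]
  refine (norm_integral_le_of_norm_le_const (C := C) (Eventually.of_forall fun t => ?_)).trans ?_
  · rw [norm_mul]
    exact (mul_le_of_le_one_left (norm_nonneg _) (norm_mFourier_apply_le _ _)).trans (hC _)
  · simp

/-- The coefficients of `Δ^k f` are bounded, and they are those of `f` times the `k`-th power of the
eigenvalue, which is at least quadratic in `‖n‖`. -/
theorem exists_norm_pow_mul_norm_coeff_le (f : Smooth d L) (k : ℕ) :
    ∃ C, ∀ n, ‖n‖ ^ (2 * k) * ‖coeff f n‖ ≤ C := by
  obtain ⟨C, hC⟩ := exists_norm_coeff_le (lap^[k] f)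
  have hpos := two_pi_div_pos (L := L)
  refine ⟨C / ((2 * Real.pi / L) ^ 2) ^ k, fun n => ?_⟩
  rw [le_div_iff₀' (by positivity), pow_mul, ← mul_assoc, ← mul_pow]
  refine le_trans ?_ (hC n)
  rw [coeff_lap_iterate, norm_mul, norm_pow]
  gcongr
  exact le_norm_eigenvalue n

/-- `ℤ^d` is a lattice of rank `d` in `ℝ^d`, and the exponent `d + 1` exceeds the rank. -/
theorem summable_norm_inv_pow (d : ℕ) :
    Summable fun n : Fin d → ℤ => ‖n‖⁻¹ ^ (d + 1) := by
  let b := Pi.basisFun ℝ (Fin d)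
  let Λ : Submodule ℤ (Fin d → ℝ) := Submodule.span ℤ (Set.range b)
  have hrank : Module.finrank ℤ Λ = d := by
    rw [ZLattice.rank ℝ Λ, Module.finrank_fin_fun]
  have hs := ZLattice.summable_norm_pow_inv Λ (d + 1) (by rw [hrank]; exact d.lt_succ_self)
  have hmem : ∀ n : Fin d → ℤ, (fun i => (n i : ℝ)) ∈ Λ := by
    intro n
    refine (b.mem_span_iff_repr_mem ℤ _).2 fun i => ⟨n i, ?_⟩
    simp [b]
  have hinj : Function.Injective fun n : Fin d → ℤ => (⟨_, hmem n⟩ : Λ) := by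
    intro n m h
    funext i
    exact Int.cast_injective (α := ℝ) (congrFun (congrArg Subtype.val h) i)
  refine (hs.comp_injective hinj).congr fun n => ?_
  rfl

theorem rapidDecay_coeff (f : Smooth d L) : RapidDecay (coeff f) := by
  intro k
  -- Of the decay, `k` powers pay for the weight and `d + 1` for summability. The bound provides
  -- twice as many, which only helps when `‖n‖ ≥ 1`.
  obtain ⟨C, hC⟩ := exists_norm_pow_mul_norm_coeff_le f (k + d + 1)
  refine Summable.of_norm_bounded_eventually ((summable_norm_inv_pow d).mul_left C) ?_
  -- The comparison may fail at `n = 0`, where the majorant is `0` because `0⁻¹ = 0`.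
  refine Set.Finite.subset (Set.finite_singleton 0) fun n hn => ?_
  by_contra hn0
  refine hn ?_
  change ‖‖n‖ ^ k * ‖coeff f n‖‖ ≤ C * ‖n‖⁻¹ ^ (d + 1)
  have h1 := one_le_norm_of_ne_zero hn0
  have hp : 0 < ‖n‖ := by linarith
  rw [Real.norm_of_nonneg (by positivity), inv_pow, ← div_eq_mul_inv, le_div_iff₀ (by positivity)]
  refine le_trans ?_ (hC n)
  calc ‖n‖ ^ k * ‖coeff f n‖ * ‖n‖ ^ (d + 1) = ‖n‖ ^ (k + d + 1) * ‖coeff f n‖ := by ring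
    _ ≤ ‖n‖ ^ (2 * (k + d + 1)) * ‖coeff f n‖ := by gcongr; omega

/-- Fourier inversion: a continuous function with summable coefficients is the pointwise sum of its
series. -/
theorem pullback_eq_series (f : Smooth d L) : pullback f = series L (coeff f) := by
  funext x
  have h := hasSum_mFourier_series_apply_of_summable
    (f := ⟨_, (continuous_smooth f).comp (continuous_scale (d := d) (L := L))⟩)
    (rapidDecay_coeff f).summable (unitProj L x)
  simp only [mFourier_unitProj] at h
  have e : (f : Torus d L → ℂ) (scale d L (unitProj L x)) = pullback f x := by
    rw [scale_unitProj]
    rfl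
  exact e.symm.trans h.tsum_eq.symm

/-! ### Kernel and image of the Laplacian -/

theorem lap_eq_zero_iff (f : Smooth d L) : lap f = 0 ↔ ∃ c : ℂ, f = const c := by
  constructor
  · intro h
    refine ⟨coeff f 0, pullback_injective ?_⟩
    rw [pullback_eq_series]
    funext x
    rw [series, tsum_eq_single 0]
    · simp [freq_apply, pullback, const]
    · intro n hn
      -- The eigenvalue is nonzero off `n = 0`, so only the constant mode of `f` can survive.
      have h1 := coeff_lap f n
      rw [h, ← coeffₗ_apply, map_zero, eq_comm, mul_eq_zero] at h1
      rw [h1.resolve_left (eigenvalue_ne_zero hn), zero_mul]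
  · rintro ⟨c, rfl⟩
    apply pullback_injective
    rw [pullback_lap]
    exact InnerProductSpace.laplacian_const

/-- The eigenvalue at `n = 0` is zero, which gives necessity. Conversely the nonzero eigenvalues are
bounded below, so dividing by them preserves rapid decay. At `n = 0` the quotient reads `0 / 0 = 0`,
which is harmless. -/
theorem exists_lap_eq_iff (g : Smooth d L) : (∃ f, lap f = g) ↔ coeff g 0 = 0 := by
  constructor
  · rintro ⟨f, rfl⟩
    rw [coeff_lap]
    simp [eigenvalue]
  · intro hg
    have hpos := two_pi_div_pos (L := L)
    have hb : RapidDecay fun n => coeff g n / eigenvalue L n := by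
      refine (rapidDecay_coeff g).of_le (((2 * Real.pi / L) ^ 2)⁻¹) 0 fun n => ?_
      rcases eq_or_ne n 0 with rfl | hn
      · simp [hg]
      · have h1 := one_le_norm_of_ne_zero hn
        have h2 : (2 * Real.pi / L) ^ 2 ≤ ‖eigenvalue L n‖ :=
          le_trans (le_mul_of_one_le_right (by positivity) (one_le_pow₀ h1)) (le_norm_eigenvalue n)
        rw [norm_div, pow_zero, mul_one, ← div_eq_inv_mul]
        gcongr
    refine ⟨ofCoeff _ hb, pullback_injective ?_⟩
    rw [pullback_lap_ofCoeff, pullback_eq_series g]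
    congr 1
    funext n
    rcases eq_or_ne n 0 with rfl | hn
    · simp [hg]
    · rw [mul_div_cancel₀ _ (eigenvalue_ne_zero hn)]

/-! ### The integral -/

/-- By uniqueness of Haar measure, the volume is a multiple of the pushed-forward probability
measure. Only the nonvanishing of the factor is needed, not its value. -/
theorem exists_integral_eq_mul_coeff_zero (d : ℕ) (L : ℝ) [hL : Fact (0 < L)] :
    ∃ r : ℂ, r ≠ 0 ∧ ∀ f : Smooth d L, integral f = r * coeff f 0 := by
  have hmap : (Measure.map (scale d L) (unitHaar d)).IsAddHaarMeasure :=
    Measure.isAddHaarMeasure_map_of_isFiniteMeasure (unitHaar d) (scale d L).toAddMonoidHom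
      continuous_scale (scale d L).surjective
  have hvol := Measure.isAddInvariant_eq_smul_of_compactSpace (volume : Measure (Torus d L))
    (Measure.map (scale d L) (unitHaar d))
  set r := Measure.addHaarScalarFactor (volume : Measure (Torus d L))
    (Measure.map (scale d L) (unitHaar d)) with hr
  refine ⟨((r : ℝ) : ℂ), ?_, fun f => ?_⟩
  · intro h0
    have hr0 : r = 0 := by exact_mod_cast h0
    rw [hr0, zero_smul] at hvol
    exact NeZero.ne (volume : Measure (Torus d L)) hvol
  · rw [integral, hvol, integral_smul_nnreal_measure, integral_map
      continuous_scale.aemeasurable (continuous_smooth f).aestronglyMeasurable, coeff_eq_integral]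
    simp only [neg_zero, mFourier_zero, ContinuousMap.one_apply, one_mul]
    rfl

theorem coeff_const_zero (c : ℂ) : coeff (const c : Smooth d L) 0 = c := by
  rw [coeff_eq_integral]
  simp [mFourier_zero, const]

/-- The integral as a linear form. -/
noncomputable def integralₗ : Smooth d L →ₗ[ℂ] ℂ where
  toFun := integral
  map_add' f g := by
    obtain ⟨r, -, hr⟩ := exists_integral_eq_mul_coeff_zero d L
    simp only [hr, ← coeffₗ_apply, map_add, mul_add]
  map_smul' c f := by
    obtain ⟨r, -, hr⟩ := exists_integral_eq_mul_coeff_zero d L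
    simp only [hr, ← coeffₗ_apply, map_smul, RingHom.id_apply, smul_eq_mul, mul_left_comm]

theorem exists_lap_eq_iff_integral (g : Smooth d L) : (∃ f, lap f = g) ↔ integral g = 0 := by
  obtain ⟨r, hr0, hr⟩ := exists_integral_eq_mul_coeff_zero d L
  rw [exists_lap_eq_iff, hr, mul_eq_zero, or_iff_right hr0]

theorem integral_const_eq_zero_iff (c : ℂ) : integral (const c : Smooth d L) = 0 ↔ c = 0 := by
  obtain ⟨r, hr0, hr⟩ := exists_integral_eq_mul_coeff_zero d L
  rw [hr, coeff_const_zero, mul_eq_zero, or_iff_right hr0]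

theorem exists_integral_const_eq (z : ℂ) : ∃ c : ℂ, integral (const c : Smooth d L) = z := by
  obtain ⟨r, hr0, hr⟩ := exists_integral_eq_mul_coeff_zero d L
  exact ⟨z / r, by rw [hr, coeff_const_zero, mul_div_cancel₀ _ hr0]⟩

end Torus

/-! ### The massless free scalar field -/

theorem FreeScalar.bvOperator_zero_apply {d : ℕ} {L : ℝ} (f : Torus.Smooth d L) :
    FreeScalar.bvOperator d L 0 f = Torus.lap f := by
  change -(-Torus.lap f + ((0 : ℝ) : ℂ) ^ 2 • f) = Torus.lap f
  simp

theorem mainTheorem3 (d : ℕ) (L : ℝ) [Fact (0 < L)] :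
    -- `f ↦ ∫ f` is a chain map from `(C^∞(T^d) → C^∞(T^d))` to `(ℂ → ℂ)` with zero differential
    (∀ f : Torus.Smooth d L, Torus.integral (FreeScalar.bvOperator d L 0 f) = 0) ∧
    -- the kernel consists of the constants, and the image of the functions with mean zero
    (∀ f : Torus.Smooth d L,
      FreeScalar.bvOperator d L 0 f = 0 ↔ ∃ c : ℂ, f = Torus.const c) ∧
    (∀ g : Torus.Smooth d L,
      (∃ f : Torus.Smooth d L, FreeScalar.bvOperator d L 0 f = g) ↔ Torus.integral g = 0) ∧
    -- the chain map induces isomorphisms on the cohomology in degrees `-1` and `0`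
    (∃ e : LinearMap.ker (FreeScalar.bvOperator d L 0) ≃ₗ[ℂ] ℂ,
      ∀ f, e f = Torus.integral (f : Torus.Smooth d L)) ∧
    (∃ e : (Torus.Smooth d L ⧸ LinearMap.range (FreeScalar.bvOperator d L 0)) ≃ₗ[ℂ] ℂ,
      ∀ g : Torus.Smooth d L, e (Submodule.Quotient.mk g) = Torus.integral g) ∧
    -- the cohomology of the classical observables is `ℂ[q, r]/(r²)` as a graded algebra
    ∃ Φ : FreeScalar.ObsCohomology d L 0 ≃ₐ[ℂ] DualPoly.Alg,
      (∀ n : ℤ, (GradedSym.cohomologyDegree (FreeScalar.bvOperator d L 0) n).map Φ.toLinearMap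
        = DualPoly.degree n) ∧
      (∀ g : Torus.Smooth d L,
        Φ (GradedSym.evenClass (FreeScalar.bvOperator d L 0) g)
          = Torus.integral g • DualPoly.q) ∧
      (∀ f : LinearMap.ker (FreeScalar.bvOperator d L 0),
        Φ (GradedSym.oddClass (FreeScalar.bvOperator d L 0) f)
          = Torus.integral (f : Torus.Smooth d L) • DualPoly.r) := by
  have hker (f : Torus.Smooth d L) :
      FreeScalar.bvOperator d L 0 f = 0 ↔ ∃ c : ℂ, f = Torus.const c := by
    rw [FreeScalar.bvOperator_zero_apply, Torus.lap_eq_zero_iff]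
  have hrange (g : Torus.Smooth d L) :
      (∃ f, FreeScalar.bvOperator d L 0 f = g) ↔ Torus.integral g = 0 := by
    simp only [FreeScalar.bvOperator_zero_apply, Torus.exists_lap_eq_iff_integral]
  have hinj (f : Torus.Smooth d L) (hf : FreeScalar.bvOperator d L 0 f = 0)
      (hf' : Torus.integral f = 0) : f = 0 := by
    obtain ⟨c, rfl⟩ := (hker f).1 hf
    rw [(Torus.integral_const_eq_zero_iff c).1 hf']
    rfl
  refine ⟨fun f => (hrange _).1 ⟨f, rfl⟩, hker, hrange, ?_, ?_, ?_⟩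
  · refine ⟨LinearEquiv.ofBijective
      (Torus.integralₗ ∘ₗ (LinearMap.ker (FreeScalar.bvOperator d L 0)).subtype) ⟨?_, ?_⟩,
      fun f => rfl⟩
    · rw [injective_iff_map_eq_zero]
      exact fun f hf => Subtype.ext (hinj f f.2 hf)
    · intro z
      obtain ⟨c, hc⟩ := Torus.exists_integral_const_eq (d := d) (L := L) z
      exact ⟨⟨Torus.const c, (hker _).2 ⟨c, rfl⟩⟩, hc⟩
  · have hle : LinearMap.range (FreeScalar.bvOperator d L 0)
        = LinearMap.ker (Torus.integralₗ (d := d) (L := L)) := by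
      ext g
      exact hrange g
    refine ⟨(Submodule.quotEquivOfEq _ _ hle).trans
      (Torus.integralₗ.quotKerEquivOfSurjective fun z => ?_), fun g => rfl⟩
    obtain ⟨c, hc⟩ := Torus.exists_integral_const_eq (d := d) (L := L) z
    exact ⟨Torus.const c, hc⟩
  -- The constant of integral `1` serves as both `i₁` and `i₀`, and the integral as both `p₁` and
  -- `p₀`.
  · obtain ⟨c, hc⟩ := Torus.exists_integral_const_eq (d := d) (L := L) 1
    obtain ⟨R, h₁, h₀⟩ := GradedSym.exists_retraction (δ := FreeScalar.bvOperator d L 0)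
      (p₁ := Torus.integralₗ) (p₀ := Torus.integralₗ) hc hc ((hker _).2 ⟨c, rfl⟩) hinj hrange
    refine ⟨R.cohomologyEquiv, R.map_cohomologyDegree, fun g => ?_, fun f => ?_⟩
    · rw [R.cohomologyEquiv_evenClass, h₀]
      rfl
    · rw [R.cohomologyEquiv_oddClass, h₁]
      rfl
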